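/- Let $n\ge 0$, $m\ge 1$, $r\ge 0$ and let $G(\lambda)\in\mathbb{C}(\lambda)^{n\times n}$ have a minimal realization $$G(\lambda)=P(\lambda)+C(\lambda E-A)^{-1}B,\qquad P(\lambda)=\sum_{j=0}^{m}\lambda^jA_j,\quad A_m\neq 0,$$ with $A_j\in\mathbb{C}^{n\times n}$, $C\in\mathbb{C}^{n\times r}$, $B\in\mathbb{C}^{r\times n}$, $A,E\in\mathbb{C}^{r\times r}$ and $E$ nonsingular (minimal: $r$ is the smallest size of the pencil $\lambda E'-A'$ among all realizations of $G(\lambda)$ as a matrix polynomial plus $C'(\lambda E'-A')^{-1}B'$ with $E'$ nonsingular). Let $$\mathcal{S}(\lambda)=\begin{bmatrix}P(\lambda)&C\\ B&A-\lambda E\end{bmatrix}$$ be its system matrix; a system matrix is called irreducible if the corresponding realization is minimal. Define the $(mn+r)\times(mn+r)$ Fiedler matrices $$\mathbb{M}_0=\begin{bmatrix}\mathrm{diag}(I_{(m-1)n},-A_0)&-e_m\otimes C\\ -e_m^T\otimes B&-A\end{bmatrix},\qquad \mathbb{M}_{-m}=\mathrm{diag}(A_m,\,I_{(m-1)n},\,-E),$$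 $$\mathbb{M}_i=\mathrm{diag}\!\left(I_{(m-i-1)n},\begin{bmatrix}-A_i&I_n\\ I_n&0\end{bmatrix},I_{(i-1)n},\,I_r\right),\qquad \mathbb{M}_{-i}=\mathbb{M}_i^{-1}\qquad(1\le i\le m-1),$$ and, when $A_m$ is nonsingular, $\mathbb{M}_m=\mathbb{M}_{-m}^{-1}$. For a tuple $t=(t_1,\dots,t_k)$ put $\mathbb{M}_t=\mathbb{M}_{t_1}\cdots\mathbb{M}_{t_k}$ (the identity if $t$ is empty) and $-t=(-t_1,\dots,-t_k)$. Let $\omega=(\omega_0,\omega_1)$ be a permutation of $\{0,1,\dots,m\}$ with $0\in\omega_0$; if $m\in\omega_0$, assume that $A_m$ is nonsingular, so that $\mathbb{M}_{\omega_0}$ is defined. Then the generalized Fiedler pencil $$\mathbb{T}_\omega(\lambda)=\lambda\,\mathbb{M}_{-\omega_1}-\mathbb{M}_{\omega_0}$$ is a Rosenbrock strong linearization of $G(\lambda)$. That is, $\mathbb{T}_\omega(\lambda)$ is an irreducible system matrix of the form $$\mathbb{T}_\omega(\lambda)=\begin{bmatrix}\mathcal{X}-\lambda\mathcal{Y}&\mathcal{C}\\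 \mathcal{B}&H-\lambda K\end{bmatrix}$$ with constant blocks $\mathcal{X},\mathcal{Y}\in\mathbb{C}^{mn\times mn}$, $\mathcal{C}\in\mathbb{C}^{mn\times r}$, $\mathcal{B}\in\mathbb{C}^{r\times mn}$, $H,K\in\mathbb{C}^{r\times r}$ and $K$ nonsingular, and: (a) there are $mn\times mn$ unimodular matrix polynomials $U(\lambda),V(\lambda)$ and nonsingular $U_0,V_0\in\mathbb{C}^{r\times r}$ such that $$\mathrm{diag}(U(\lambda),U_0)\,\mathbb{T}_\omega(\lambda)\,\mathrm{diag}(V(\lambda),V_0)=\mathrm{diag}(I_{(m-1)n},\mathcal{S}(\lambda));$$ (b) there are $mn\times mn$ biproper rational matrices $\mathcal{O}_\ell(\lambda),\mathcal{O}_r(\lambda)$ (rational matrices with a nonsingular limit as $\lambda\to\infty$) such that $$\mathcal{O}_\ell(\lambda)\,\lambda^{-1}\mathbb{G}(\lambda)\,\mathcal{O}_r(\lambda)=\mathrm{diag}(I_{(m-1)n},\lambda^{-m}G(\lambda)),$$ where $\mathbb{G}(\lambda)=\mathcal{X}-\lambda\mathcal{Y}+\mathcal{C}(\lambda K-H)^{-1}\mathcal{B}$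 is the transfer function of $\mathbb{T}_\omega(\lambda)$. -/

import Mathlib

namespace RatMat

open Polynomial

/-! ### Realizations, system matrices, transfer functions -/

/-- A realization `P(λ) + C (λ E - A)⁻¹ B`, with `P` a matrix polynomial, `λ E - A` an
`r × r` pencil and `E` nonsingular. -/
structure Realization (ι : Type*) (r : ℕ) where
  P : Matrix ι ι ℂ[X]
  C : Matrix ι (Fin r) ℂ
  E : Matrix (Fin r) (Fin r) ℂ
  A : Matrix (Fin r) (Fin r) ℂ
  B : Matrix (Fin r) ι ℂ
  nonsingular : IsUnit E.det

namespace Realization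

variable {ι : Type*} {r : ℕ}

/-- The coefficient `A_j` of `λ ^ j` in `P(λ)`. -/
noncomputable def coeff (S : Realization ι r) (j : ℕ) : Matrix ι ι ℂ :=
  S.P.map fun p => p.coeff j

/-- The rational matrix `P(λ) + C (λ E - A)⁻¹ B`.  Since `E` is nonsingular, the matrix
`λ E - A` is invertible over `ℂ(λ)`. -/
noncomputable def transferFunction (S : Realization ι r) : Matrix ι ι (RatFunc ℂ) :=
  S.P.map (algebraMap ℂ[X] (RatFunc ℂ)) +
    S.C.map RatFunc.C * ((RatFunc.X : RatFunc ℂ) • S.E.map RatFunc.C - S.A.map RatFunc.C)⁻¹ *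
      S.B.map RatFunc.C

/-- The system matrix `[P(λ), C; B, A - λ E]`. -/
noncomputable def systemMatrix (S : Realization ι r) : Matrix (ι ⊕ Fin r) (ι ⊕ Fin r) ℂ[X] :=
  Matrix.fromBlocks S.P (S.C.map Polynomial.C) (S.B.map Polynomial.C)
    (S.A.map Polynomial.C - (X : ℂ[X]) • S.E.map Polynomial.C)

/-- The realization is minimal: the size `r` of the pencil `λ E - A` is the smallest among all
realizations of the same rational matrix.  The system matrix is called irreducible if the
realization is minimal. -/
def IsMinimal (S : Realization ι r) : Prop :=
  ∀ (r' : ℕ) (S' : Realization ι r'), S'.transferFunction = S.transferFunction → r ≤ r'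

end Realization

/-! ### Block matrices

The index set `Fin m × ι` stands for `m` blocks of size `ι`; the last block (number `m`) is the
one whose `0`-based index `i` satisfies `i + 1 = m`. -/

section Blocks

variable {ι κ R : Type*}

/-- `diag(I, …, I, Z)`, with `m` diagonal blocks. -/
def lastDiag (m : ℕ) [DecidableEq ι] [Zero R] [One R] (Z : Matrix ι ι R) :
    Matrix (Fin m × ι) (Fin m × ι) R :=
  Matrix.of fun i j =>
    (if i.1 = j.1 then if (i.1 : ℕ) + 1 = m then Z else 1 else 0 : Matrix ι ι R) i.2 j.2

/-- `e_m ⊗ Z`. -/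
def lastCol (m : ℕ) [Zero R] (Z : Matrix ι κ R) : Matrix (Fin m × ι) κ R :=
  Matrix.of fun i k => if (i.1 : ℕ) + 1 = m then Z i.2 k else 0

/-- `e_mᵀ ⊗ Z`. -/
def lastRow (m : ℕ) [Zero R] (Z : Matrix κ ι R) : Matrix κ (Fin m × ι) R :=
  Matrix.of fun k j => if (j.1 : ℕ) + 1 = m then Z k j.2 else 0

/-- `diag(I, …, I, Z)`, with `m - 1` identity blocks of size `ι`, for a matrix `Z` that is itself
partitioned into `2 × 2` blocks. -/
def padIdentity (m : ℕ) [DecidableEq ι] [Zero R] [One R] (Z : Matrix (ι ⊕ κ) (ι ⊕ κ) R) :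
    Matrix ((Fin m × ι) ⊕ κ) ((Fin m × ι) ⊕ κ) R :=
  Matrix.fromBlocks (lastDiag m Z.toBlocks₁₁) (lastCol m Z.toBlocks₁₂)
    (lastRow m Z.toBlocks₂₁) Z.toBlocks₂₂

end Blocks

/-! ### Rosenbrock strong linearizations -/

/-- A matrix polynomial is unimodular if its determinant is a nonzero constant. -/
def IsUnimodular {ι : Type*} [Fintype ι] [DecidableEq ι] (U : Matrix ι ι ℂ[X]) : Prop :=
  ∃ c : ℂ, c ≠ 0 ∧ U.det = Polynomial.C c

/-- A rational matrix `F(λ)` is biproper if `F(λ)` tends to a nonsingular matrix as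
`λ → ∞`. -/
def IsBiproper {ι : Type*} [Fintype ι] [DecidableEq ι] (F : Matrix ι ι (RatFunc ℂ)) : Prop :=
  ∃ D : Matrix ι ι ℂ, IsUnit D.det ∧
    Filter.Tendsto (fun z : ℂ => F.map fun f => f.eval (RingHom.id ℂ) z)
      (Bornology.cobounded ℂ) (nhds D)

/-- `L(λ)` is a Rosenbrock strong linearization of the rational matrix `G(λ)`, whose system
matrix is that of the realization `S`: `L(λ) = [𝒳 - λ 𝒴, 𝒞; ℬ, H - λ K]` is an irreducible system
matrix with `K` nonsingular, such that (a) and (b) below hold. -/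
def IsRosenbrockStrongLinearization {n r : ℕ} (m : ℕ) (G : Matrix (Fin n) (Fin n) (RatFunc ℂ))
    (S : Realization (Fin n) r)
    (L : Matrix ((Fin m × Fin n) ⊕ Fin r) ((Fin m × Fin n) ⊕ Fin r) ℂ[X]) : Prop :=
  ∃ T : Realization (Fin m × Fin n) r,
    (∃ 𝒳 𝒴 : Matrix (Fin m × Fin n) (Fin m × Fin n) ℂ,
      T.P = 𝒳.map Polynomial.C - (X : ℂ[X]) • 𝒴.map Polynomial.C) ∧
    L = T.systemMatrix ∧
    T.IsMinimal ∧
    -- (a)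
    (∃ (U V : Matrix (Fin m × Fin n) (Fin m × Fin n) ℂ[X]) (U₀ V₀ : Matrix (Fin r) (Fin r) ℂ),
      IsUnimodular U ∧ IsUnimodular V ∧ IsUnit U₀.det ∧ IsUnit V₀.det ∧
      Matrix.fromBlocks U 0 0 (U₀.map Polynomial.C) * L *
          Matrix.fromBlocks V 0 0 (V₀.map Polynomial.C) =
        padIdentity m S.systemMatrix) ∧
    -- (b)
    (∃ Oℓ Oᵣ : Matrix (Fin m × Fin n) (Fin m × Fin n) (RatFunc ℂ),
      IsBiproper Oℓ ∧ IsBiproper Oᵣ ∧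
      Oℓ * ((RatFunc.X : RatFunc ℂ)⁻¹ • T.transferFunction) * Oᵣ =
        lastDiag m (((RatFunc.X : RatFunc ℂ) ^ m)⁻¹ • G))

/-! ### Fiedler matrices and generalized Fiedler pencils -/

section Fiedler

variable {n r : ℕ}

/-- `M_{-m}(Z) = diag(Z, I, …, I)`. -/
def firstDiag (m : ℕ) (Z : Matrix (Fin n) (Fin n) ℂ) :
    Matrix (Fin m × Fin n) (Fin m × Fin n) ℂ :=
  Matrix.of fun i j =>
    (if i.1 = j.1 then if (i.1 : ℕ) = 0 then Z else 1 else 0 :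
      Matrix (Fin n) (Fin n) ℂ) i.2 j.2

/-- `M_i(Z) = diag(I_{(m-i-1)n}, [Z, I; I, 0], I_{(i-1)n})`, for `1 ≤ i ≤ m - 1`. -/
def elementary (m i : ℕ) (Z : Matrix (Fin n) (Fin n) ℂ) :
    Matrix (Fin m × Fin n) (Fin m × Fin n) ℂ :=
  Matrix.of fun a b =>
    (if (a.1 : ℕ) + i + 1 = m ∧ (b.1 : ℕ) + i + 1 = m then Z
    else if (a.1 : ℕ) + i + 1 = m ∧ (b.1 : ℕ) + i = m then 1
    else if (a.1 : ℕ) + i = m ∧ (b.1 : ℕ) + i + 1 = m then 1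
    else if (a.1 : ℕ) + i = m ∧ (b.1 : ℕ) + i = m then 0
    else if a.1 = b.1 then 1
    else 0 : Matrix (Fin n) (Fin n) ℂ) a.2 b.2

/-- The Fiedler matrix with index `0`: `[M_0(-A_0), -(e_m ⊗ C); -(e_mᵀ ⊗ B), -A]`. -/
noncomputable def fiedlerZero (m : ℕ) (S : Realization (Fin n) r) :
    Matrix ((Fin m × Fin n) ⊕ Fin r) ((Fin m × Fin n) ⊕ Fin r) ℂ :=
  Matrix.fromBlocks (lastDiag m (-S.coeff 0)) (-lastCol m S.C) (-lastRow m S.B) (-S.A)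

/-- The Fiedler matrix with index `i`, for `1 ≤ i ≤ m - 1`: `diag(M_i(-A_i), I_r)`. -/
noncomputable def fiedlerPos (m : ℕ) (S : Realization (Fin n) r) (i : ℕ) :
    Matrix ((Fin m × Fin n) ⊕ Fin r) ((Fin m × Fin n) ⊕ Fin r) ℂ :=
  Matrix.fromBlocks (elementary m i (-S.coeff i)) 0 0 1

/-- The Fiedler matrix with index `-m`: `diag(M_{-m}(A_m), -E)`. -/
noncomputable def fiedlerNegTop (m : ℕ) (S : Realization (Fin n) r) :
    Matrix ((Fin m × Fin n) ⊕ Fin r) ((Fin m × Fin n) ⊕ Fin r) ℂ :=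
  Matrix.fromBlocks (firstDiag m (S.coeff m)) 0 0 (-S.E)

/-- The Fiedler matrix with index `i`, for `-m ≤ i ≤ m`.  The ones with index `-1, …, -(m-1)` are
the inverses of those with index `1, …, m-1`, and the one with index `m` is the inverse of the one
with index `-m` (to be used only if `A_m` is nonsingular). -/
noncomputable def fiedler (m : ℕ) (S : Realization (Fin n) r) (i : ℤ) :
    Matrix ((Fin m × Fin n) ⊕ Fin r) ((Fin m × Fin n) ⊕ Fin r) ℂ :=
  if i = 0 then fiedlerZero m S
  else if i = -(m : ℤ) then fiedlerNegTop m S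
  else if i = (m : ℤ) then (fiedlerNegTop m S)⁻¹
  else if 0 < i then fiedlerPos m S i.natAbs
  else (fiedlerPos m S i.natAbs)⁻¹

/-- The product of the Fiedler matrices with indices `t = (t₁, …, t_k)`, in this order; the
identity if `t` is empty. -/
noncomputable def fiedlerProd (m : ℕ) (S : Realization (Fin n) r) (t : List ℤ) :
    Matrix ((Fin m × Fin n) ⊕ Fin r) ((Fin m × Fin n) ⊕ Fin r) ℂ :=
  (t.map (fiedler m S)).prod

/-- The generalized Fiedler pencil `λ M_{-ω₁} - M_{ω₀}`. -/
noncomputable def gfp (m : ℕ) (S : Realization (Fin n) r) (ω₀ ω₁ : List ℕ) :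
    Matrix ((Fin m × Fin n) ⊕ Fin r) ((Fin m × Fin n) ⊕ Fin r) ℂ[X] :=
  (X : ℂ[X]) • (fiedlerProd m S (ω₁.map fun k => -(k : ℤ))).map Polynomial.C -
    (fiedlerProd m S (ω₀.map fun k => (k : ℤ))).map Polynomial.C

end Fiedler

end RatMat

/-! The pencil reduces to a single shape. Write ω₀ = (σ₁, 0, σ₂). The matrices 𝕄_i with i ≠ 0 used
here are block diagonal and invertible, so 𝕋_ω = 𝕄_{σ₁} (λ 𝕄_{-τ} - 𝕄_0) 𝕄_{σ₂}, where τ = (rev σ₁,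
ω₁, rev σ₂) is a permutation of 1, …, m (`exists_fiedlerProd_eq`). With τ = (α, m, β), the
polynomial part of the middle factor is λ M_{-α} D(A_m) M_{-β} - M_0, a matrix over the
noncommutative ring of n × n blocks.

Such a pencil is reduced by Horner's scheme (`exists_isUnit_mul_pencil_mul`). Suppose D carries z in
block k + 1. The index k + 1 occurs in α or in β, and D commutes with the smaller factors, so D can
be brought next to the factor of index k + 1. Block k + 1 then has the constant pivot -1, coming
from -M_0, and eliminating it replaces z by A_{k+1} + λz in block k. After the last step, P(λ)
stands in the corner. The row and column operations fix the corner block, which is the only block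
that meets C and B. The equivalence therefore extends to the whole system matrix and gives (a).

For (b), put l = 1/λ and cancel 𝕄_{σ₁}, 𝕄_{σ₂}, which are constant. The transfer function divided by
λ becomes M_{-α} D(A_m) M_{-β} - l M_0, in which A_0 has absorbed the proper matrix C(λE - A)⁻¹B.
Multiplying by M_{-α}⁻¹ and M_{-β}⁻¹ and numbering the blocks from the other end turns this into the
negative of a pencil of the same shape with reversed coefficients. The same elimination, now over
the ring of proper rational functions, produces λ^{-m}G(λ); units of the matrix ring over proper
functions are biproper (`isBiproper_map_of_isUnit`).

For irreducibility, (a) exhibits G as a product U·𝔾·V with polynomial U and V. Division by the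
pencil λE - A shows that such products do not need a larger state space
(`exists_realization_mul_mul`), so a smaller realization of 𝔾 would give a smaller one of G. -/

namespace RatMat

open Polynomial
open Matrix Finset

/-! ### Horner elimination over a noncommutative ring of blocks -/

section BlockElimination

variable {𝓐 κ : Type*} [Ring 𝓐] [Fintype κ] [DecidableEq κ]

/-- The identity matrix with the rows and columns `p`, `q` replaced by `[0, 1; 1, z]`. -/
def swapBlock (p q : κ) (z : 𝓐) : Matrix κ κ 𝓐 :=
  1 + (single p q 1 + single q p 1 + single q q (z - 1) - single p p 1)

/-- The identity matrix with the diagonal entry `p` replaced by `z`. -/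
def cornerDiag (p : κ) (z : 𝓐) : Matrix κ κ 𝓐 :=
  1 + single p p (z - 1)

/-- The diagonal matrix with entry `z` at `pos k`, entries `1` at `pos j` for `j < k`, and `0`
elsewhere. -/
def partialDiag (pos : ℕ → κ) (k : ℕ) (z : 𝓐) : Matrix κ κ 𝓐 :=
  ∑ j ∈ range k, single (pos j) (pos j) 1 + single (pos k) (pos k) z

/-- The product of the matrices `swapBlock (pos j) (pos (j - 1)) (A j)`, for `j` in a list. -/
def swapProd (pos : ℕ → κ) (A : ℕ → 𝓐) (α : List ℕ) : Matrix κ κ 𝓐 :=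
  (α.map fun j => swapBlock (pos j) (pos (j - 1)) (A j)).prod

theorem swapBlock_mul_swapBlock {p q : κ} (h : p ≠ q) (z : 𝓐) :
    swapBlock p q z * swapBlock q p (-z) = 1 := by
  simp only [swapBlock, mul_add, add_mul, mul_sub, sub_mul, mul_one, one_mul,
    single_mul_single_same, single_mul_single_of_ne _ _ _ _ h,
    single_mul_single_of_ne _ _ _ _ h.symm]
  simp only [sub_eq_add_neg, single_add, ← single_neg]
  abel

theorem single_mul_swapBlock_left {p q : κ} (h : p ≠ q) (x : κ) (c z : 𝓐) :
    single x p c * swapBlock p q z = single x q c := by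
  simp [swapBlock, mul_add, mul_sub, single_mul_single_of_ne _ _ _ _ h]

theorem single_mul_swapBlock_right {p q : κ} (h : p ≠ q) (x : κ) (c z : 𝓐) :
    single x q c * swapBlock p q z = single x p c + single x q (c * z) := by
  simp only [swapBlock, mul_add, mul_one, single_mul_single_same,
    single_mul_single_of_ne _ _ _ _ h.symm, sub_eq_add_neg, single_add, ← single_neg, mul_neg]
  abel

theorem single_mul_swapBlock_of_ne {p q y : κ} (hp : y ≠ p) (hq : y ≠ q) (x : κ) (c z : 𝓐) :
    single x y c * swapBlock p q z = single x y c := by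
  simp [swapBlock, mul_add, mul_sub, single_mul_single_of_ne _ _ _ _ hp,
    single_mul_single_of_ne _ _ _ _ hq]

theorem swapBlock_mul_single_left {p q : κ} (h : p ≠ q) (x : κ) (c z : 𝓐) :
    swapBlock p q z * single p x c = single q x c := by
  simp [swapBlock, add_mul, sub_mul, single_mul_single_of_ne _ _ _ _ h.symm]

theorem swapBlock_mul_single_right {p q : κ} (h : p ≠ q) (x : κ) (c z : 𝓐) :
    swapBlock p q z * single q x c = single p x c + single q x (z * c) := by
  simp only [swapBlock, add_mul, one_mul, single_mul_single_same,
    single_mul_single_of_ne _ _ _ _ h, sub_eq_add_neg, single_add, ← single_neg, neg_mul]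
  abel

theorem swapBlock_mul_single_of_ne {p q y : κ} (hp : p ≠ y) (hq : q ≠ y) (x : κ) (c z : 𝓐) :
    swapBlock p q z * single y x c = single y x c := by
  simp [swapBlock, add_mul, sub_mul, single_mul_single_of_ne _ _ _ _ hp,
    single_mul_single_of_ne _ _ _ _ hq]

theorem swapProd_append (pos : ℕ → κ) (A : ℕ → 𝓐) (α β : List ℕ) :
    swapProd pos A (α ++ β) = swapProd pos A α * swapProd pos A β := by
  simp [swapProd]

theorem swapProd_cons (pos : ℕ → κ) (A : ℕ → 𝓐) (j : ℕ) (α : List ℕ) :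
    swapProd pos A (j :: α) = swapBlock (pos j) (pos (j - 1)) (A j) * swapProd pos A α := by
  simp [swapProd]

omit [Fintype κ] in
theorem partialDiag_succ (pos : ℕ → κ) (k : ℕ) (z : 𝓐) :
    partialDiag pos (k + 1) z = partialDiag pos k 1 + single (pos (k + 1)) (pos (k + 1)) z := by
  simp [partialDiag, sum_range_succ]

omit [Fintype κ] in
theorem partialDiag_add (pos : ℕ → κ) (k : ℕ) (z w : 𝓐) :
    partialDiag pos k (z + w) = partialDiag pos k z + single (pos k) (pos k) w := by
  simp [partialDiag, single_add, add_assoc]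

section Injective

variable {pos : ℕ → κ} {k : ℕ} (hpos : ∀ i ≤ k + 1, ∀ j ≤ k + 1, pos i = pos j → i = j)
include hpos

theorem sum_single_mul_swapBlock (A : 𝓐) :
    (∑ j ∈ range k, single (pos j) (pos j) (1 : 𝓐)) * swapBlock (pos (k + 1)) (pos k) A =
      ∑ j ∈ range k, single (pos j) (pos j) 1 := by
  rw [sum_mul]
  refine sum_congr rfl fun j hj => ?_
  have hj := mem_range.1 hj
  refine single_mul_swapBlock_of_ne (fun h => ?_) (fun h => ?_) _ _ _
  · have := hpos _ (by omega) _ (by omega) h; omega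
  · have := hpos _ (by omega) _ (by omega) h; omega

theorem swapBlock_mul_sum_single (A : 𝓐) :
    swapBlock (pos (k + 1)) (pos k) A * (∑ j ∈ range k, single (pos j) (pos j) (1 : 𝓐)) =
      ∑ j ∈ range k, single (pos j) (pos j) 1 := by
  rw [mul_sum]
  refine sum_congr rfl fun j hj => ?_
  have hj := mem_range.1 hj
  refine swapBlock_mul_single_of_ne (fun h => ?_) (fun h => ?_) _ _ _
  · have := hpos _ (by omega) _ (by omega) h; omega
  · have := hpos _ (by omega) _ (by omega) h; omega

omit [Fintype κ] [DecidableEq κ] in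
theorem pos_succ_ne : pos (k + 1) ≠ pos k := fun h => by
  have := hpos _ le_rfl _ (by omega) h
  omega

/-- The factor of index k + 1 moves z off the diagonal and leaves `A` in block k, which prepares the
elimination of block k + 1. Multiplying from the other side puts z in the transposed position. -/
theorem partialDiag_mul_swapBlock (z A : 𝓐) :
    partialDiag pos (k + 1) z * swapBlock (pos (k + 1)) (pos k) A =
      partialDiag pos k A + single (pos (k + 1)) (pos k) z + single (pos k) (pos (k + 1)) 1 := by
  rw [partialDiag_succ, partialDiag, add_mul, add_mul, sum_single_mul_swapBlock hpos,
    single_mul_swapBlock_right (pos_succ_ne hpos), single_mul_swapBlock_left (pos_succ_ne hpos),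
    partialDiag, one_mul]
  abel

theorem swapBlock_mul_partialDiag (z A : 𝓐) :
    swapBlock (pos (k + 1)) (pos k) A * partialDiag pos (k + 1) z =
      partialDiag pos k A + single (pos (k + 1)) (pos k) 1 + single (pos k) (pos (k + 1)) z := by
  rw [partialDiag_succ, partialDiag, mul_add, mul_add, swapBlock_mul_sum_single hpos,
    swapBlock_mul_single_right (pos_succ_ne hpos), swapBlock_mul_single_left (pos_succ_ne hpos),
    partialDiag, mul_one]
  abel

theorem single_mul_swapProd (A : ℕ → 𝓐) (x : κ) (c : 𝓐) (α : List ℕ)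
    (hα : ∀ j ∈ α, 1 ≤ j ∧ j ≤ k) :
    single x (pos (k + 1)) c * swapProd pos A α = single x (pos (k + 1)) c := by
  induction α with
  | nil => simp [swapProd]
  | cons j α ih =>
    have hj := hα j (by simp)
    rw [swapProd_cons, ← mul_assoc, single_mul_swapBlock_of_ne,
      ih fun i hi => hα i (by simp [hi])]
    · intro h; have := hpos _ le_rfl _ (by omega) h; omega
    · intro h; have := hpos _ le_rfl _ (by omega) h; omega

theorem swapProd_mul_single (A : ℕ → 𝓐) (x : κ) (c : 𝓐) (α : List ℕ)
    (hα : ∀ j ∈ α, 1 ≤ j ∧ j ≤ k) :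
    swapProd pos A α * single (pos (k + 1)) x c = single (pos (k + 1)) x c := by
  induction α with
  | nil => simp [swapProd]
  | cons j α ih =>
    have hj := hα j (by simp)
    rw [swapProd_cons, mul_assoc, ih fun i hi => hα i (by simp [hi]), swapBlock_mul_single_of_ne]
    · intro h; have := hpos _ (by omega) _ le_rfl h; omega
    · intro h; have := hpos _ (by omega) _ le_rfl h; omega

theorem single_mul_partialDiag (x : κ) (c z : 𝓐) :
    single x (pos (k + 1)) c * partialDiag pos k z = 0 := by
  rw [partialDiag, mul_add, mul_sum, sum_eq_zero, zero_add,
    single_mul_single_of_ne _ _ _ _ (pos_succ_ne hpos)]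
  intro j hj
  have hj := mem_range.1 hj
  refine single_mul_single_of_ne _ _ _ _ (fun h => ?_) _
  have := hpos _ le_rfl _ (by omega) h
  omega

theorem partialDiag_mul_single (x : κ) (c z : 𝓐) :
    partialDiag pos k z * single (pos (k + 1)) x c = 0 := by
  rw [partialDiag, add_mul, sum_mul, sum_eq_zero, zero_add,
    single_mul_single_of_ne _ _ _ _ (pos_succ_ne hpos).symm]
  intro j hj
  have hj := mem_range.1 hj
  refine single_mul_single_of_ne _ _ _ _ (fun h => ?_) _
  have := hpos _ (by omega) _ le_rfl h
  omega

theorem partialDiag_one_mul_single {j : ℕ} (hj : j ≤ k) (x : κ) (c : 𝓐) :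
    partialDiag pos k 1 * single (pos j) x c = single (pos j) x c := by
  have : partialDiag pos k (1 : 𝓐) = ∑ j ∈ range (k + 1), single (pos j) (pos j) 1 := by
    simp [partialDiag, sum_range_succ]
  rw [this, sum_mul, sum_eq_single_of_mem j (mem_range.2 (by omega))]
  · simp
  · intro i hi hij
    have hi := mem_range.1 hi
    exact single_mul_single_of_ne _ _ _ _ (fun h => hij (hpos _ (by omega) _ (by omega) h)) _

theorem single_mul_partialDiag_one {j : ℕ} (hj : j ≤ k) (x : κ) (c : 𝓐) :
    single x (pos j) c * partialDiag pos k 1 = single x (pos j) c := by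
  have : partialDiag pos k (1 : 𝓐) = ∑ j ∈ range (k + 1), single (pos j) (pos j) 1 := by
    simp [partialDiag, sum_range_succ]
  rw [this, mul_sum, sum_eq_single_of_mem j (mem_range.2 (by omega))]
  · simp
  · intro i hi hij
    have hi := mem_range.1 hi
    exact single_mul_single_of_ne _ _ _ _ (fun h => hij (hpos _ (by omega) _ (by omega) h).symm) _

/-- Factors of index at most k act only on positions 0, …, k, where the diagonal matrix is the
identity; they do not touch the entry z at position k + 1. -/
theorem commute_partialDiag_swapProd (A : ℕ → 𝓐) (z : 𝓐) (α : List ℕ)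
    (hα : ∀ j ∈ α, 1 ≤ j ∧ j ≤ k) :
    Commute (partialDiag pos (k + 1) z) (swapProd pos A α) := by
  rw [partialDiag_succ]
  refine Commute.add_left ?_ ?_
  · refine Commute.list_prod_right _ _ fun y hy => ?_
    obtain ⟨j, hj, rfl⟩ := List.mem_map.1 hy
    have hj := hα j hj
    refine (Commute.one_right _).add_right ?_
    rw [Commute, SemiconjBy]
    simp only [mul_add, mul_sub, add_mul, sub_mul,
      partialDiag_one_mul_single hpos hj.2, single_mul_partialDiag_one hpos hj.2,
      partialDiag_one_mul_single hpos (show j - 1 ≤ k by omega),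
      single_mul_partialDiag_one hpos (show j - 1 ≤ k by omega)]
  · rw [Commute, SemiconjBy, single_mul_swapProd hpos A _ _ α hα,
      swapProd_mul_single hpos A _ _ α hα]

theorem single_mul_cornerDiag (x : κ) (c z : 𝓐) :
    single x (pos (k + 1)) c * cornerDiag (pos 0) z = single x (pos (k + 1)) c := by
  rw [cornerDiag, mul_add, mul_one, single_mul_single_of_ne, add_zero]
  intro h; have := hpos _ le_rfl _ (by omega) h; omega

theorem cornerDiag_mul_single (x : κ) (c z : 𝓐) :
    cornerDiag (pos 0) z * single (pos (k + 1)) x c = single (pos (k + 1)) x c := by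
  rw [cornerDiag, add_mul, one_mul, single_mul_single_of_ne, add_zero]
  intro h; have := hpos _ (by omega) _ le_rfl h; omega

end Injective

theorem isUnit_one_add_of_mul_self {T : Type*} [Ring T] {a : T} (h : a * a = 0) :
    IsUnit (1 + a) := by
  refine ⟨⟨1 + a, 1 - a, ?_, ?_⟩, rfl⟩ <;> simp [mul_sub, sub_mul, mul_add, add_mul, h]

/-- A Schur complement in ring form: `Q` acts as the pivot -1 on the block through which `a` and `b`
factor, so clearing them leaves the correction `a * b`. -/
theorem one_add_mul_mul_one_add {T : Type*} [Ring T] {a b Q : T} (haQ : a * Q = -a)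
    (hQb : Q * b = -b) (ha : a * a = 0) (hb : b * b = 0) :
    (1 + a) * (Q + b + a) * (1 + b) = Q + a * b := by
  have : (1 + a) * (Q + b + a) = Q + b + a * b := by
    simp only [add_mul, mul_add, one_mul, haQ, ha]
    abel
  rw [this]
  simp only [add_mul, mul_add, mul_one, hQb, hb, mul_assoc, mul_zero]
  abel

variable {R : Type*} [CommRing R] [Algebra R 𝓐]

/-- One elimination step: if the coefficient matrix of `l` has the form
`M_α (D_k(A) + [0, z; w, 0]) M_β`, then the block number `k + 1` can be split off. -/
theorem exists_elimination_step {pos : ℕ → κ} {k : ℕ}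
    (hpos : ∀ i ≤ k + 1, ∀ j ≤ k + 1, pos i = pos j → i = j) (l : R) (A : ℕ → 𝓐)
    (A₀ A₁ z w : 𝓐) (α β : List ℕ) (hα : ∀ j ∈ α, 1 ≤ j ∧ j ≤ k)
    (hβ : ∀ j ∈ β, 1 ≤ j ∧ j ≤ k) :
    ∃ U V : Matrix κ κ 𝓐, IsUnit U ∧ IsUnit V ∧
      U * single (pos 0) (pos 0) 1 = single (pos 0) (pos 0) 1 ∧
      single (pos 0) (pos 0) 1 * V = single (pos 0) (pos 0) 1 ∧
      U * (l • (swapProd pos A α * (partialDiag pos k A₁ + single (pos (k + 1)) (pos k) z +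
          single (pos k) (pos (k + 1)) w) * swapProd pos A β) - cornerDiag (pos 0) A₀) * V =
        l • (swapProd pos A α * partialDiag pos k (A₁ + l • (w * z)) * swapProd pos A β) -
          cornerDiag (pos 0) A₀ := by
  have hne : pos (k + 1) ≠ pos 0 := fun h => by
    have := hpos _ le_rfl _ (by omega) h
    omega
  set Mα := swapProd pos A α with hMα
  set Mβ := swapProd pos A β with hMβ
  set a := l • (Mα * single (pos k) (pos (k + 1)) w) with ha
  set b := l • (single (pos (k + 1)) (pos k) z * Mβ) with hb
  set Q := l • (Mα * partialDiag pos k A₁ * Mβ) - cornerDiag (pos 0) A₀ with hQ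
  -- Row and column k + 1 of `Q` contain only the pivot -1: the diagonal matrix vanishes there, the
  -- swap factors act trivially, and `cornerDiag` contributes the identity entry.
  have haQ : a * Q = -a := by
    have h1 : single (pos k) (pos (k + 1)) w * Q = -single (pos k) (pos (k + 1)) w := by
      rw [hQ, mul_sub, mul_smul_comm, ← mul_assoc, ← mul_assoc, hMα,
        single_mul_swapProd hpos A _ _ α hα, single_mul_partialDiag hpos, zero_mul, smul_zero,
        single_mul_cornerDiag hpos, zero_sub]
    rw [ha, smul_mul_assoc, mul_assoc, h1, mul_neg, smul_neg]
  have hQb : Q * b = -b := by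
    have h1 : Q * single (pos (k + 1)) (pos k) z = -single (pos (k + 1)) (pos k) z := by
      rw [hQ, sub_mul, smul_mul_assoc, mul_assoc, hMβ,
        swapProd_mul_single hpos A _ _ β hβ, mul_assoc, partialDiag_mul_single hpos, mul_zero,
        smul_zero, cornerDiag_mul_single hpos, zero_sub]
    rw [hb, mul_smul_comm, ← mul_assoc, h1, neg_mul, smul_neg]
  have haa : a * a = 0 := by
    rw [ha, smul_mul_assoc, mul_smul_comm, mul_assoc, ← mul_assoc (single _ _ _) Mα, hMα,
      single_mul_swapProd hpos A _ _ α hα, single_mul_single_of_ne _ _ _ _ (pos_succ_ne hpos)]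
    simp
  have hbb : b * b = 0 := by
    rw [hb, smul_mul_assoc, mul_smul_comm, mul_assoc, ← mul_assoc Mβ, hMβ,
      swapProd_mul_single hpos A _ _ β hβ, ← mul_assoc,
      single_mul_single_of_ne _ _ _ _ (pos_succ_ne hpos).symm]
    simp
  refine ⟨1 + a, 1 + b, isUnit_one_add_of_mul_self haa, isUnit_one_add_of_mul_self hbb,
    ?_, ?_, ?_⟩
  -- All columns of `a` except k + 1 vanish, and k + 1 is not the corner position, so `1 + a` fixes
  -- the corner; the same holds for the rows of `b`.
  · rw [add_mul, one_mul, ha, smul_mul_assoc, mul_assoc, single_mul_single_of_ne _ _ _ _ hne]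
    simp
  · rw [mul_add, mul_one, hb, mul_smul_comm, ← mul_assoc,
      single_mul_single_of_ne _ _ _ _ hne.symm]
    simp
  · have e : l • (Mα * (partialDiag pos k A₁ + single (pos (k + 1)) (pos k) z +
          single (pos k) (pos (k + 1)) w) * Mβ) - cornerDiag (pos 0) A₀ = Q + b + a := by
      rw [mul_add, mul_add, add_mul, add_mul, mul_assoc Mα (single _ _ w), hMα, hMβ,
        single_mul_swapProd hpos A _ _ β hβ, swapProd_mul_single hpos A _ _ α hα, hQ, ha, hb]
      simp only [smul_add]
      abel
    rw [e, one_add_mul_mul_one_add haQ hQb haa hbb, partialDiag_add, mul_add, add_mul, smul_add,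
      hQ, ha, hb, smul_mul_assoc, mul_smul_comm, mul_assoc Mα (single _ _ w),
      ← mul_assoc (single _ _ w), single_mul_single_same, ← smul_single, mul_smul_comm,
      smul_mul_assoc, mul_assoc Mα (single _ _ (w * z))]
    abel

/-- The pencil `l M_α D(z) M_β - M_0` is equivalent to `diag(-1, …, -1, ∑ l ^ j A_j)`, by
transformations that fix the last block column, respectively the last block row. -/
theorem exists_isUnit_mul_pencil_mul (l : R) {pos : ℕ → κ} (A : ℕ → 𝓐) (k : ℕ)
    (hpos : ∀ i ≤ k, ∀ j ≤ k, pos i = pos j → i = j) (z : 𝓐) (α β : List ℕ)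
    (hαβ : (α ++ β).Perm (List.range' 1 k)) :
    ∃ U V : Matrix κ κ 𝓐, IsUnit U ∧ IsUnit V ∧
      U * single (pos 0) (pos 0) 1 = single (pos 0) (pos 0) 1 ∧
      single (pos 0) (pos 0) 1 * V = single (pos 0) (pos 0) 1 ∧
      U * (l • (swapProd pos A α * partialDiag pos k z * swapProd pos A β) -
          cornerDiag (pos 0) (-A 0)) * V =
        -cornerDiag (pos 0) (-(∑ j ∈ range (k + 1), l ^ j • A j + l ^ (k + 1) • z)) := by
  -- The entry z has to vary because each step replaces it by A_{k+1} + l z; the lists vary because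
  -- the index k + 1 is removed from them.
  induction k generalizing z α β with
  | zero =>
    obtain ⟨rfl, rfl⟩ : α = [] ∧ β = [] := by simpa using hαβ
    refine ⟨1, 1, isUnit_one, isUnit_one, by simp, by simp, ?_⟩
    simp [swapProd, partialDiag, cornerDiag, single_add, ← single_neg, sub_eq_add_neg,
      -neg_add_rev]
    abel
  | succ k ih =>
    have hk : k + 1 ∈ α ++ β := hαβ.mem_iff.2 (List.mem_range'_1.2 (by omega))
    -- This covers both places where k + 1 can occur: (x, y) = (1, z) if it lies in α, and (z, 1) if
    -- it lies in β. The elimination sees only the product y x = z.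
    have key : ∀ (α β : List ℕ) (x y : 𝓐), (α ++ β).Perm (List.range' 1 k) → y * x = z →
        ∃ U V : Matrix κ κ 𝓐, IsUnit U ∧ IsUnit V ∧
          U * single (pos 0) (pos 0) 1 = single (pos 0) (pos 0) 1 ∧
          single (pos 0) (pos 0) 1 * V = single (pos 0) (pos 0) 1 ∧
          U * (l • (swapProd pos A α * (partialDiag pos k (A (k + 1)) +
            single (pos (k + 1)) (pos k) x + single (pos k) (pos (k + 1)) y) *
              swapProd pos A β) - cornerDiag (pos 0) (-A 0)) * V =
          -cornerDiag (pos 0)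
            (-(∑ j ∈ range (k + 1 + 1), l ^ j • A j + l ^ (k + 1 + 1) • z)) := by
      intro α β x y hp hxy
      have hmem : ∀ j ∈ α ++ β, 1 ≤ j ∧ j ≤ k := fun j hj => by
        have := hp.mem_iff.1 hj
        rw [List.mem_range'_1] at this
        omega
      obtain ⟨U, V, hU, hV, hU', hV', h⟩ := exists_elimination_step hpos l A (-A 0) (A (k + 1))
        x y α β (fun j hj => hmem j (by simp [hj])) (fun j hj => hmem j (by simp [hj]))
      obtain ⟨U₁, V₁, hU₁, hV₁, hU₁', hV₁', h₁⟩ := ih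
        (fun i hi j hj => hpos i (by omega) j (by omega)) (A (k + 1) + l • (y * x)) α β hp
      refine ⟨U₁ * U, V * V₁, hU₁.mul hU, hV.mul hV₁, by rw [mul_assoc, hU', hU₁'],
        by rw [← mul_assoc, hV', hV₁'], ?_⟩
      have assoc : ∀ K, U₁ * U * K * (V * V₁) = U₁ * (U * K * V) * V₁ := fun K => by
        simp only [mul_assoc]
      rw [assoc, h, h₁, hxy,
        sum_range_succ _ (k + 1), smul_add, smul_smul, ← pow_succ, ← add_assoc (Finset.sum _ _)]
    have hperm : List.range' 1 (k + 1) = List.range' 1 k ++ [k + 1] := by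
      rw [List.range'_concat]; simp [add_comm]
    rw [hperm] at hαβ
    rcases List.mem_append.1 hk with hk | hk
    · obtain ⟨α₁, α₂, rfl⟩ := List.append_of_mem hk
      have hp : (α₁ ++ (α₂ ++ β)).Perm (List.range' 1 k) := by
        have h1 : ((k + 1) :: (α₁ ++ (α₂ ++ β))).Perm ((k + 1) :: List.range' 1 k) := by
          refine List.Perm.trans ?_ (hαβ.trans (List.perm_append_singleton _ _))
          simpa using (List.perm_middle (a := k + 1) (l₁ := α₁) (l₂ := α₂ ++ β)).symm
        exact h1.cons_inv
      obtain ⟨U, V, hU, hV, hU', hV', h⟩ := key α₁ (α₂ ++ β) 1 z hp (by simp)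
      refine ⟨U, V, hU, hV, hU', hV', ?_⟩
      rw [← h]
      -- The diagonal matrix moves left past the factors of `α₂` until it meets the factor of index
      -- k + 1.
      have hc := commute_partialDiag_swapProd hpos A z α₂ fun j hj => by
        have := hp.mem_iff.1 (show j ∈ _ by simp [hj])
        rw [List.mem_range'_1] at this
        omega
      rw [swapProd_append, swapProd_append, swapProd_cons, ← swapBlock_mul_partialDiag hpos]
      simp only [mul_assoc, add_tsub_cancel_right]
      rw [← mul_assoc _ (partialDiag pos (k + 1) z), ← hc.eq]
      simp only [mul_assoc]
    · obtain ⟨β₁, β₂, rfl⟩ := List.append_of_mem hk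
      have hp : ((α ++ β₁) ++ β₂).Perm (List.range' 1 k) := by
        have h1 : ((k + 1) :: ((α ++ β₁) ++ β₂)).Perm ((k + 1) :: List.range' 1 k) := by
          refine List.Perm.trans ?_ (hαβ.trans (List.perm_append_singleton _ _))
          simpa using (List.perm_middle (a := k + 1) (l₁ := α ++ β₁) (l₂ := β₂)).symm
        exact h1.cons_inv
      obtain ⟨U, V, hU, hV, hU', hV', h⟩ := key (α ++ β₁) β₂ z 1 hp (by simp)
      refine ⟨U, V, hU, hV, hU', hV', ?_⟩
      rw [← h]
      have hc := commute_partialDiag_swapProd hpos A z β₁ fun j hj => by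
        have := hp.mem_iff.1 (show j ∈ _ by simp [hj])
        rw [List.mem_range'_1] at this
        omega
      rw [swapProd_append, swapProd_append, swapProd_cons, ← partialDiag_mul_swapBlock hpos]
      simp only [mul_assoc, add_tsub_cancel_right]
      rw [← mul_assoc _ (swapProd pos A β₁), hc.eq]
      simp only [mul_assoc]

end BlockElimination

/-! ### Change of the coefficient ring, and the full diagonal matrix -/

section BlockMaps

variable {κ 𝓐 𝓑 : Type*} [DecidableEq κ] [Ring 𝓐] [Ring 𝓑]

theorem map_swapBlock (f : 𝓐 →+* 𝓑) (p q : κ) (z : 𝓐) :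
    (swapBlock p q z).map f = swapBlock p q (f z) := by
  ext i j
  simp only [swapBlock, map_apply, Matrix.add_apply, Matrix.sub_apply, map_add, map_sub, single_apply, one_apply,
    apply_ite f, map_one, map_zero]

theorem map_cornerDiag (f : 𝓐 →+* 𝓑) (p : κ) (z : 𝓐) :
    (cornerDiag p z).map f = cornerDiag p (f z) := by
  ext i j
  simp only [cornerDiag, map_apply, Matrix.add_apply, map_sub, map_add, single_apply, one_apply,
    apply_ite f, map_one, map_zero]

theorem map_swapProd [Fintype κ] (f : 𝓐 →+* 𝓑) (pos : ℕ → κ) (A : ℕ → 𝓐) (α : List ℕ) :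
    (swapProd pos A α).map f = swapProd pos (fun j => f (A j)) α := by
  induction α with
  | nil => simp [swapProd]
  | cons j α ih => rw [swapProd_cons, swapProd_cons, Matrix.map_mul, ih, map_swapBlock]

/-- The positions 0, …, k exhaust the index set, so no zero diagonal entries remain. -/
theorem partialDiag_eq_cornerDiag [Fintype κ] {pos : ℕ → κ} {k : ℕ}
    (hpos : ∀ i ≤ k, ∀ j ≤ k, pos i = pos j → i = j) (hκ : Fintype.card κ = k + 1) (z : 𝓐) :
    partialDiag pos k z = cornerDiag (pos k) z := by
  have h1 : ∑ j ∈ range (k + 1), single (pos j) (pos j) (1 : 𝓐) = 1 := by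
    have himg : (range (k + 1)).image pos = univ := by
      apply Finset.eq_univ_of_card
      rw [card_image_of_injOn, card_range, hκ]
      intro i hi j hj h
      have hi := mem_range.1 hi
      have hj := mem_range.1 hj
      exact hpos i (by omega) j (by omega) h
    have := Finset.sum_image (s := range (k + 1)) (g := pos)
      (f := fun i => single i i (1 : 𝓐)) (fun i hi j hj h => by
        have hi := mem_range.1 hi
        have hj := mem_range.1 hj
        exact hpos i (by omega) j (by omega) h)
    rw [← this, himg]
    ext i j
    simp only [Matrix.sum_apply, single_apply, one_apply]
    by_cases h : i = j
    · simp [h]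
    · rw [if_neg h, sum_eq_zero]
      intro x _
      rw [if_neg]
      rintro ⟨rfl, rfl⟩
      exact h rfl
  rw [sum_range_succ] at h1
  rw [partialDiag, cornerDiag, ← h1, add_assoc, ← single_add]
  simp

end BlockMaps

/-! ### The two numberings of the blocks -/

section Positions

/-- The blocks numbered from the last one. -/
def posDown (M j : ℕ) : Fin (M + 1) := ⟨M - j, by omega⟩

/-- The blocks numbered from the first one. -/
def posUp (M j : ℕ) : Fin (M + 1) := ⟨min j M, by omega⟩

theorem posDown_injOn (M : ℕ) : ∀ i ≤ M, ∀ j ≤ M, posDown M i = posDown M j → i = j := by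
  intro i hi j hj h
  simp only [posDown, Fin.mk.injEq] at h
  omega

theorem posUp_injOn (M : ℕ) : ∀ i ≤ M, ∀ j ≤ M, posUp M i = posUp M j → i = j := by
  intro i hi j hj h
  simp only [posUp, Fin.mk.injEq] at h
  omega

theorem posUp_sub (M : ℕ) {j : ℕ} (hj : j ≤ M) : posUp M (M - j) = posDown M j := by
  simp only [posUp, posDown, Fin.mk.injEq]
  omega

end Positions

/-! ### From matrices of blocks to matrices of scalars -/

section Flatten

variable {M n : ℕ} {R : Type*} [CommRing R]

/-- Matrices of `n × n` blocks as matrices. -/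
abbrev flatten (M n : ℕ) (R : Type*) [CommRing R] :
    Matrix (Fin (M + 1)) (Fin (M + 1)) (Matrix (Fin n) (Fin n) R) ≃+*
      Matrix (Fin (M + 1) × Fin n) (Fin (M + 1) × Fin n) R :=
  compRingEquiv (Fin (M + 1)) (Fin n) R

theorem flatten_apply (X : Matrix (Fin (M + 1)) (Fin (M + 1)) (Matrix (Fin n) (Fin n) R))
    (i j : Fin (M + 1)) (a b : Fin n) : flatten M n R X (i, a) (j, b) = X i j a b := rfl

theorem lastDiag_eq (Z : Matrix (Fin n) (Fin n) R) :
    lastDiag (M + 1) Z = flatten M n R (cornerDiag (posDown M 0) Z) := by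
  ext ⟨i, a⟩ ⟨j, b⟩
  simp only [lastDiag, of_apply, flatten_apply, cornerDiag, Matrix.add_apply,
    single_apply, one_apply, posDown, Fin.ext_iff]
  by_cases h : (i : ℕ) = j
  · by_cases h' : (i : ℕ) + 1 = M + 1
    · rw [if_pos h, if_pos h', if_pos h, if_pos (by omega)]
      simp
    · rw [if_pos h, if_neg h', if_pos h, if_neg (by omega)]
      simp
  · rw [if_neg h, if_neg h, if_neg (by omega)]
    simp

theorem firstDiag_eq (Z : Matrix (Fin n) (Fin n) ℂ) :
    firstDiag (M + 1) Z = flatten M n ℂ (cornerDiag (posDown M M) Z) := by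
  ext ⟨i, a⟩ ⟨j, b⟩
  simp only [firstDiag, of_apply, flatten_apply, cornerDiag, Matrix.add_apply,
    single_apply, one_apply, posDown, Fin.ext_iff]
  by_cases h : (i : ℕ) = j
  · by_cases h' : (i : ℕ) = 0
    · rw [if_pos h, if_pos h', if_pos h, if_pos (by omega)]
      simp
    · rw [if_pos h, if_neg h', if_pos h, if_neg (by omega)]
      simp
  · rw [if_neg h, if_neg h, if_neg (by omega)]
    simp

theorem elementary_eq {i : ℕ} (h1 : 1 ≤ i) (hi : i ≤ M) (Z : Matrix (Fin n) (Fin n) ℂ) :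
    elementary (M + 1) i Z =
      flatten M n ℂ (swapBlock (posDown M (i - 1)) (posDown M i) Z) := by
  ext ⟨x, a⟩ ⟨y, b⟩
  simp only [elementary, of_apply, flatten_apply, swapBlock, Matrix.add_apply,
    Matrix.sub_apply, single_apply, one_apply, posDown, Fin.ext_iff]
  have e1 : (x : ℕ) + i + 1 = M + 1 ↔ M - i = x := by omega
  have e2 : (y : ℕ) + i + 1 = M + 1 ↔ M - i = y := by omega
  have e3 : (x : ℕ) + i = M + 1 ↔ M - (i - 1) = x := by omega
  have e4 : (y : ℕ) + i = M + 1 ↔ M - (i - 1) = y := by omega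
  simp only [e1, e2, e3, e4]
  by_cases hxp : M - i = x <;> by_cases hyp : M - i = y <;>
    by_cases hxq : M - (i - 1) = x <;> by_cases hyq : M - (i - 1) = y
  all_goals first
    | omega
    | split_ifs
  all_goals first
    | omega
    | simp

/-- With this factorization, a matrix that fixes the corner idempotent also fixes every coupling
column e_m ⊗ Z. -/
theorem lastCol_eq_mul {κ : Type*} (Z : Matrix (Fin n) κ R) :
    flatten M n R (single (posDown M 0) (posDown M 0) 1) * lastCol (M + 1) Z =
      lastCol (M + 1) Z := by
  ext ⟨i, a⟩ b
  simp only [mul_apply, Fintype.sum_prod_type, flatten_apply, lastCol, of_apply,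
    single_apply, posDown, Fin.ext_iff]
  by_cases h : (i : ℕ) = M
  · rw [sum_eq_single_of_mem i (mem_univ _), sum_eq_single_of_mem a (mem_univ _)]
    · simp [h]
    · intro c _ hc
      simp [h, one_apply_ne hc.symm]
    · intro j _ hj
      have : (j : ℕ) ≠ i := fun h => hj (Fin.ext h)
      simp [show ¬ M = (j : ℕ) by omega]
  · rw [sum_eq_zero]
    · simp [h]
    · intro j _
      simp [show ¬ M = (i : ℕ) by omega]

theorem lastRow_eq_mul {κ : Type*} (Z : Matrix κ (Fin n) R) :
    lastRow (M + 1) Z * flatten M n R (single (posDown M 0) (posDown M 0) 1) =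
      lastRow (M + 1) Z := by
  ext b ⟨i, a⟩
  simp only [mul_apply, Fintype.sum_prod_type, flatten_apply, lastRow, of_apply,
    single_apply, posDown, Fin.ext_iff]
  by_cases h : (i : ℕ) = M
  · rw [sum_eq_single_of_mem i (mem_univ _), sum_eq_single_of_mem a (mem_univ _)]
    · simp [h]
    · intro c _ hc
      simp [h, one_apply_ne hc]
    · intro j _ hj
      have : (j : ℕ) ≠ i := fun h => hj (Fin.ext h)
      simp [show ¬ M = (j : ℕ) by omega]
  · rw [sum_eq_zero]
    · simp [h]
    · intro j _
      simp [show ¬ M = (i : ℕ) by omega]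

variable {m r : ℕ}

/-- The state space contribution to the transfer function sits in the corner block, so it can be
merged with the corner entry. -/
theorem lastDiag_add (Z : Matrix (Fin n) (Fin n) R) (C : Matrix (Fin n) (Fin r) R)
    (Y : Matrix (Fin r) (Fin r) R) (B : Matrix (Fin r) (Fin n) R) :
    lastDiag m (Z + C * Y * B) = lastDiag m Z + lastCol m C * Y * lastRow m B := by
  ext ⟨i, a⟩ ⟨j, b⟩
  simp only [lastDiag, of_apply, Matrix.add_apply, mul_apply, lastCol, lastRow]
  by_cases hi : (i : ℕ) + 1 = m <;> by_cases hj : (j : ℕ) + 1 = m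
  · have h : i = j := Fin.ext (by omega)
    subst h
    simp [hi, mul_apply]
  · have h : i ≠ j := fun h => hj (by rw [← h]; omega)
    simp [h, hj]
  · have h : i ≠ j := fun h => hi (by rw [h]; omega)
    simp [h, hi]
  · simp [hi, hj]

variable {κ ι R' : Type*} [CommRing R']

theorem map_lastDiag (f : R →+* R') [DecidableEq ι] (Z : Matrix ι ι R) :
    (lastDiag m Z).map f = lastDiag m (Z.map f) := by
  ext i j
  simp only [lastDiag, map_apply, of_apply]
  split_ifs <;> simp [one_apply, apply_ite f]

theorem map_lastCol (f : R →+* R') (Z : Matrix ι κ R) :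
    (lastCol m Z).map f = lastCol m (Z.map f) := by
  ext i j
  simp only [lastCol, map_apply, of_apply]
  split_ifs <;> simp

theorem map_lastRow (f : R →+* R') (Z : Matrix κ ι R) :
    (lastRow m Z).map f = lastRow m (Z.map f) := by
  ext i j
  simp only [lastRow, map_apply, of_apply]
  split_ifs <;> simp

end Flatten

/-! ### Products of Fiedler matrices and the normal form of the pencil -/

section FiedlerProducts

variable {M n r : ℕ} (S : Realization (Fin n) r)

theorem fromBlocks_diag_mul {a b R : Type*} [Fintype a] [Fintype b] [CommRing R]
    (X X' : Matrix a a R) (Y Y' : Matrix b b R) :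
    fromBlocks X 0 0 Y * fromBlocks X' 0 0 Y' = fromBlocks (X * X') 0 0 (Y * Y') := by
  simp [fromBlocks_multiply]

theorem isUnit_of_mul_eq_one_and {T : Type*} [Ring T] {x y : T} (h : x * y = 1)
    (h' : y * x = 1) : IsUnit x := ⟨⟨x, y, h, h'⟩, rfl⟩

theorem posDown_sub_one_ne {i : ℕ} (h1 : 1 ≤ i) (hi : i ≤ M) :
    posDown M (i - 1) ≠ posDown M i := fun h => by
  have := posDown_injOn M _ (by omega) _ hi h
  omega

theorem fiedlerPos_eq {i : ℕ} (h1 : 1 ≤ i) (hi : i ≤ M) :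
    fiedlerPos (M + 1) S i = fromBlocks
      (flatten M n ℂ (swapBlock (posDown M (i - 1)) (posDown M i) (-S.coeff i))) 0 0 1 := by
  rw [fiedlerPos, elementary_eq h1 hi]

theorem fiedlerPos_mul {i : ℕ} (h1 : 1 ≤ i) (hi : i ≤ M) :
    fiedlerPos (M + 1) S i * fromBlocks
      (flatten M n ℂ (swapBlock (posDown M i) (posDown M (i - 1)) (S.coeff i))) 0 0 1 =
        1 := by
  have := swapBlock_mul_swapBlock (posDown_sub_one_ne h1 hi) (-S.coeff i)
  rw [neg_neg] at this
  rw [fiedlerPos_eq S h1 hi, fromBlocks_diag_mul, ← map_mul, this, map_one, mul_one,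
    fromBlocks_one]

theorem fiedler_neg_eq {i : ℕ} (h1 : 1 ≤ i) (hi : i ≤ M) :
    fiedler (M + 1) S (-(i : ℤ)) = fromBlocks
      (flatten M n ℂ (swapBlock (posDown M i) (posDown M (i - 1)) (S.coeff i))) 0 0 1 := by
  rw [fiedler, if_neg (by omega), if_neg (by push_cast; omega), if_neg (by push_cast; omega),
    if_neg (by omega), Int.natAbs_neg, Int.natAbs_natCast]
  exact inv_eq_right_inv (fiedlerPos_mul S h1 hi)

theorem fiedler_pos_eq {i : ℕ} (h1 : 1 ≤ i) (hi : i ≤ M) :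
    fiedler (M + 1) S (i : ℤ) = fiedlerPos (M + 1) S i := by
  rw [fiedler, if_neg (by omega), if_neg (by push_cast; omega), if_neg (by push_cast; omega),
    if_pos (by omega), Int.natAbs_natCast]

theorem fiedler_neg_top :
    fiedler (M + 1) S (-((M + 1 : ℕ) : ℤ)) = fiedlerNegTop (M + 1) S := by
  rw [fiedler, if_neg (by push_cast; omega), if_pos rfl]

theorem fiedler_top : fiedler (M + 1) S ((M + 1 : ℕ) : ℤ) = (fiedlerNegTop (M + 1) S)⁻¹ := by
  rw [fiedler, if_neg (by push_cast; omega), if_neg (by push_cast; omega), if_pos rfl]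

theorem cornerDiag_mul {κ 𝓐 : Type*} [Fintype κ] [DecidableEq κ] [Ring 𝓐] (p : κ) (z w : 𝓐) :
    cornerDiag p z * cornerDiag p w = cornerDiag p (z * w) := by
  simp only [cornerDiag, mul_add, add_mul, one_mul, mul_one, single_mul_single_same]
  rw [add_assoc, ← single_add, ← single_add]
  congr 2
  noncomm_ring

theorem cornerDiag_one {κ 𝓐 : Type*} [DecidableEq κ] [Ring 𝓐] (p : κ) :
    cornerDiag p (1 : 𝓐) = 1 := by
  simp [cornerDiag]

theorem fiedlerNegTop_mul (h : IsUnit (S.coeff (M + 1)).det) :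
    fiedlerNegTop (M + 1) S *
      fromBlocks (firstDiag (M + 1) (S.coeff (M + 1))⁻¹) 0 0 (-S.E⁻¹) = 1 := by
  rw [fiedlerNegTop, fromBlocks_diag_mul, firstDiag_eq, firstDiag_eq, ← map_mul, cornerDiag_mul,
    mul_nonsing_inv _ h, cornerDiag_one, map_one, neg_mul_neg, mul_nonsing_inv _ S.nonsingular,
    fromBlocks_one]

/-- The Fiedler matrices with index different from `0` are block diagonal and invertible, the
inverse having the opposite index. -/
theorem fiedler_invertible {i : ℕ} (h1 : 1 ≤ i) (hi : i ≤ M + 1)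
    (hinv : i = M + 1 → IsUnit (S.coeff (M + 1)).det) :
    (∃ Φ R, IsUnit Φ ∧ IsUnit R ∧ fiedler (M + 1) S (i : ℤ) = fromBlocks Φ 0 0 R) ∧
      fiedler (M + 1) S (i : ℤ) * fiedler (M + 1) S (-(i : ℤ)) = 1 ∧
      fiedler (M + 1) S (-(i : ℤ)) * fiedler (M + 1) S (i : ℤ) = 1 := by
  rcases Nat.lt_or_ge M i with hM | hM
  · obtain rfl : i = M + 1 := by omega
    have hm := fiedlerNegTop_mul S (hinv rfl)
    have hm' := mul_eq_one_comm.1 hm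
    rw [fiedler_top, fiedler_neg_top, inv_eq_right_inv hm]
    refine ⟨⟨_, _, ?_, ?_, rfl⟩, hm', hm⟩
    · rw [firstDiag_eq]
      refine IsUnit.map _ (isUnit_of_mul_eq_one_and (y := cornerDiag (posDown M M) (S.coeff (M + 1))) ?_ ?_)
      · rw [cornerDiag_mul, nonsing_inv_mul _ (hinv rfl), cornerDiag_one]
      · rw [cornerDiag_mul, mul_nonsing_inv _ (hinv rfl), cornerDiag_one]
    · refine IsUnit.neg ?_
      rw [isUnit_nonsing_inv_iff]
      exact (isUnit_iff_isUnit_det _).2 S.nonsingular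
  · have hm := fiedlerPos_mul S h1 hM
    have hm' := mul_eq_one_comm.1 hm
    rw [fiedler_neg_eq S h1 hM, fiedler_pos_eq S h1 hM]
    refine ⟨⟨_, _, ?_, isUnit_one, fiedlerPos_eq S h1 hM⟩, hm, hm'⟩
    have e1 := swapBlock_mul_swapBlock (posDown_sub_one_ne h1 hM) (-S.coeff i)
    have e2 := swapBlock_mul_swapBlock (posDown_sub_one_ne h1 hM).symm (S.coeff i)
    rw [neg_neg] at e1
    exact IsUnit.map _ (isUnit_of_mul_eq_one_and e1 e2)

theorem fiedlerProd_append (m : ℕ) (s t : List ℤ) :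
    fiedlerProd m S (s ++ t) = fiedlerProd m S s * fiedlerProd m S t := by
  simp [fiedlerProd]

theorem fiedlerProd_cons (m : ℕ) (i : ℤ) (t : List ℤ) :
    fiedlerProd m S (i :: t) = fiedler m S i * fiedlerProd m S t := by
  simp [fiedlerProd]

theorem fiedlerProd_invertible (σ : List ℕ) (hσ : ∀ i ∈ σ, 1 ≤ i ∧ i ≤ M + 1)
    (hinv : M + 1 ∈ σ → IsUnit (S.coeff (M + 1)).det) :
    (∃ Φ R, IsUnit Φ ∧ IsUnit R ∧
        fiedlerProd (M + 1) S (σ.map fun k : ℕ => (k : ℤ)) = fromBlocks Φ 0 0 R) ∧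
      fiedlerProd (M + 1) S (σ.map fun k : ℕ => (k : ℤ)) *
        fiedlerProd (M + 1) S (σ.reverse.map fun k : ℕ => -(k : ℤ)) = 1 ∧
      fiedlerProd (M + 1) S (σ.reverse.map fun k : ℕ => -(k : ℤ)) *
        fiedlerProd (M + 1) S (σ.map fun k : ℕ => (k : ℤ)) = 1 := by
  induction σ with
  | nil => exact ⟨⟨1, 1, isUnit_one, isUnit_one, by simp [fiedlerProd]⟩, by simp [fiedlerProd],
      by simp [fiedlerProd]⟩
  | cons i σ ih =>
    obtain ⟨⟨Φ, R, hΦ, hR, h⟩, h1, h2⟩ := ih (fun j hj => hσ j (by simp [hj]))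
      (fun hj => hinv (by simp [hj]))
    have hi := hσ i (by simp)
    obtain ⟨⟨Φ', R', hΦ', hR', h'⟩, h1', h2'⟩ := fiedler_invertible S hi.1 hi.2
      (fun hj => hinv (by simp [hj]))
    simp only [List.map_cons, List.reverse_cons, List.map_append, fiedlerProd_cons,
      fiedlerProd_append, List.map_nil]
    refine ⟨⟨Φ' * Φ, R' * R, hΦ'.mul hΦ, hR'.mul hR, by rw [h, h', fromBlocks_diag_mul]⟩, ?_, ?_⟩
    · rw [mul_assoc, ← mul_assoc (fiedlerProd _ _ (σ.map _)), h1, one_mul]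
      simp [fiedlerProd, h1']
    · rw [mul_assoc, ← mul_assoc _ (fiedler _ _ _) (fiedlerProd _ _ _)]
      simp only [fiedlerProd, List.map_nil, List.prod_nil, mul_one] at *
      rw [h2', one_mul, h2]

theorem fiedlerProd_neg (α : List ℕ) (hα : ∀ i ∈ α, 1 ≤ i ∧ i ≤ M) :
    fiedlerProd (M + 1) S (α.map fun k : ℕ => -(k : ℤ)) =
      fromBlocks (flatten M n ℂ (swapProd (posDown M) S.coeff α)) 0 0 1 := by
  induction α with
  | nil =>
    simp only [fiedlerProd, swapProd, List.map_nil, List.prod_nil, map_one, fromBlocks_one]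
  | cons i α ih =>
    have hi := hα i (by simp)
    rw [List.map_cons, fiedlerProd_cons, ih fun j hj => hα j (by simp [hj]),
      fiedler_neg_eq S hi.1 hi.2, fromBlocks_diag_mul, ← map_mul, mul_one, swapProd_cons]

/-- The coefficient of `λ` in a generalized Fiedler pencil, up to constant factors. -/
noncomputable def leadingBlock (M : ℕ) (S : Realization (Fin n) r) (α β : List ℕ) :
    Matrix (Fin (M + 1)) (Fin (M + 1)) (Matrix (Fin n) (Fin n) ℂ) :=
  swapProd (posDown M) S.coeff α * partialDiag (posDown M) M (S.coeff (M + 1)) *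
    swapProd (posDown M) S.coeff β

/-- All generalized Fiedler pencils are, up to multiplication by constant invertible block
diagonal matrices, of the form `λ M_{-τ} - M_0` with a permutation `τ` of `1, …, m`. -/
theorem exists_fiedlerProd_eq (ω₀ ω₁ : List ℕ) (hω : (ω₀ ++ ω₁).Perm (List.range (M + 1 + 1)))
    (h0 : 0 ∈ ω₀) (hinv : M + 1 ∈ ω₀ → IsUnit (S.coeff (M + 1)).det) :
    ∃ (Φ₁ Φ₂ : Matrix (Fin (M + 1) × Fin n) (Fin (M + 1) × Fin n) ℂ)
      (R₁ R₂ : Matrix (Fin r) (Fin r) ℂ) (α β : List ℕ),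
      IsUnit Φ₁ ∧ IsUnit Φ₂ ∧ IsUnit R₁ ∧ IsUnit R₂ ∧ (α ++ β).Perm (List.range' 1 M) ∧
      fiedlerProd (M + 1) S (ω₀.map fun k : ℕ => (k : ℤ)) =
        fromBlocks Φ₁ 0 0 R₁ * fiedlerZero (M + 1) S * fromBlocks Φ₂ 0 0 R₂ ∧
      fiedlerProd (M + 1) S (ω₁.map fun k : ℕ => -(k : ℤ)) =
        fromBlocks Φ₁ 0 0 R₁ *
          fromBlocks (flatten M n ℂ (leadingBlock M S α β)) 0 0 (-S.E) *
            fromBlocks Φ₂ 0 0 R₂ := by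
  obtain ⟨σ₁, σ₂, rfl⟩ := List.append_of_mem h0
  -- This list is τ: the inverses of the factors around 𝕄_0 are moved into the coefficient of λ.
  -- Inverting a product reverses its order.
  have hperm : (σ₁.reverse ++ ω₁ ++ σ₂.reverse).Perm (List.range' 1 (M + 1)) := by
    have : (0 :: (σ₁.reverse ++ ω₁ ++ σ₂.reverse)).Perm (0 :: List.range' 1 (M + 1)) := by
      rw [show 0 :: List.range' 1 (M + 1) = List.range (M + 1 + 1) by
        rw [List.range_eq_range']; rfl]
      refine List.Perm.trans ?_ hω
      rw [List.perm_iff_count]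
      intro a
      simp only [List.count_append, List.count_cons, List.count_reverse]
      omega
    exact this.cons_inv
  have hmem : ∀ i ∈ σ₁.reverse ++ ω₁ ++ σ₂.reverse, 1 ≤ i ∧ i ≤ M + 1 := fun i hi => by
    have := List.mem_range'_1.1 (hperm.mem_iff.1 hi)
    omega
  obtain ⟨⟨Φ₁, R₁, hΦ₁, hR₁, e₁⟩, h₁, -⟩ := fiedlerProd_invertible S σ₁
    (fun i hi => hmem i (by simp [hi])) (fun h => hinv (by simp [h]))
  obtain ⟨⟨Φ₂, R₂, hΦ₂, hR₂, e₂⟩, -, h₂⟩ := fiedlerProd_invertible S σ₂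
    (fun i hi => hmem i (by simp [hi])) (fun h => hinv (by simp [h]))
  obtain ⟨α, β, hτ⟩ := List.append_of_mem
    (hperm.mem_iff.2 (List.mem_range'_1.2 (⟨by omega, by omega⟩ : 1 ≤ M + 1 ∧ M + 1 < 1 + (M + 1))))
  have hαβ : (α ++ β).Perm (List.range' 1 M) := by
    have : ((M + 1) :: (α ++ β)).Perm ((M + 1) :: List.range' 1 M) := by
      refine List.perm_middle.symm.trans ((hτ ▸ hperm).trans ?_)
      rw [List.range'_concat, show 1 + 1 * M = M + 1 by omega]
      exact List.perm_append_singleton _ _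
    exact this.cons_inv
  have hmem' : ∀ i ∈ α ++ β, 1 ≤ i ∧ i ≤ M := fun i hi => by
    have := List.mem_range'_1.1 (hαβ.mem_iff.1 hi)
    omega
  refine ⟨Φ₁, Φ₂, R₁, R₂, α, β, hΦ₁, hΦ₂, hR₁, hR₂, hαβ, ?_, ?_⟩
  · rw [List.map_append, List.map_cons, fiedlerProd_append, fiedlerProd_cons, e₁, e₂, mul_assoc]
    congr 2
  · have e : fromBlocks (flatten M n ℂ (leadingBlock M S α β)) 0 0 (-S.E) =
        fiedlerProd (M + 1) S ((σ₁.reverse ++ ω₁ ++ σ₂.reverse).map fun k : ℕ => -(k : ℤ)) := by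
      rw [hτ, List.map_append, List.map_cons, fiedlerProd_append, fiedlerProd_cons,
        fiedlerProd_neg S α fun i hi => hmem' i (by simp [hi]),
        fiedlerProd_neg S β fun i hi => hmem' i (by simp [hi]), fiedler_neg_top, fiedlerNegTop,
        firstDiag_eq, fromBlocks_diag_mul, fromBlocks_diag_mul, ← map_mul, ← map_mul, leadingBlock,
        partialDiag_eq_cornerDiag (posDown_injOn M) (by simp), mul_assoc, mul_one, one_mul]
    rw [e, List.map_append, List.map_append, fiedlerProd_append, fiedlerProd_append, ← e₁, ← e₂,
      ← mul_assoc, ← mul_assoc, h₁, one_mul, mul_assoc, h₂, mul_one]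

/-- In `gfp` the cast to ℤ is a coercion of the whole list, after which the map acts on integers;
here the cast is made entry by entry. -/
theorem gfp_eq (m : ℕ) (ω₀ ω₁ : List ℕ) :
    gfp m S ω₀ ω₁ =
      (X : ℂ[X]) • (fiedlerProd m S (ω₁.map fun k : ℕ => -(k : ℤ))).map Polynomial.C -
        (fiedlerProd m S (ω₀.map fun k : ℕ => (k : ℤ))).map Polynomial.C := by
  have e : ∀ l : List ℕ, (do let a ← l; pure (a : ℤ)) = l.map fun k : ℕ => (k : ℤ) := by
    intro l
    induction l with
    | nil => rfl
    | cons a l ih => simp_all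
  rw [gfp, e, e, List.map_map, List.map_map]
  rfl

end FiedlerProducts

/-! ### Reduction of the pencil at finite points and at infinity -/

section Pencils

variable {𝓐 R : Type*} [Ring 𝓐] [CommRing R] [Algebra R 𝓐] {M : ℕ}

theorem cornerDiag_neg_one_mul_self {κ : Type*} [Fintype κ] [DecidableEq κ] (p : κ) :
    cornerDiag p (-1 : 𝓐) * cornerDiag p (-1) = 1 := by
  rw [cornerDiag_mul, neg_mul_neg, one_mul, cornerDiag_one]

/-- Finite linearization property of the pencils `λ M_{-τ} - M_0`. -/
theorem exists_isUnit_mul_fiedler_mul (l : R) (A : ℕ → 𝓐) (α β : List ℕ)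
    (hαβ : (α ++ β).Perm (List.range' 1 M)) :
    ∃ U V : Matrix (Fin (M + 1)) (Fin (M + 1)) 𝓐, IsUnit U ∧ IsUnit V ∧
      U * single (posDown M 0) (posDown M 0) 1 = single (posDown M 0) (posDown M 0) 1 ∧
      single (posDown M 0) (posDown M 0) 1 * V = single (posDown M 0) (posDown M 0) 1 ∧
      U * (l • (swapProd (posDown M) A α * partialDiag (posDown M) M (A (M + 1)) *
          swapProd (posDown M) A β) - cornerDiag (posDown M 0) (-A 0)) * V =
        cornerDiag (posDown M 0) (∑ j ∈ range (M + 1 + 1), l ^ j • A j) := by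
  obtain ⟨U, V, hU, hV, hU', hV', h⟩ := exists_isUnit_mul_pencil_mul l A M (posDown_injOn M)
    (A (M + 1)) α β hαβ
  have hs := cornerDiag_neg_one_mul_self (𝓐 := 𝓐) (posDown M 0)
  -- The extra factor is diag(-1, …, -1, 1): it turns the pivots -1 into 1 and still fixes the
  -- corner.
  refine ⟨-cornerDiag (posDown M 0) (-1) * U, V, (IsUnit.neg ⟨⟨_, _, hs, hs⟩, rfl⟩).mul hU, hV,
    ?_, hV', ?_⟩
  · rw [mul_assoc, hU', cornerDiag, neg_mul, add_mul, one_mul, single_mul_single_same,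
      ← single_add, single_neg]
    congr 1
    noncomm_ring
  · rw [mul_assoc, mul_assoc, ← mul_assoc U, h, neg_mul_neg, cornerDiag_mul, neg_mul_neg, one_mul,
      sum_range_succ _ (M + 1)]

/-- The inverse of [0, 1; 1, z] is [-z, 1; 1, 0], the same kind of block with its two positions
exchanged. Numbering from the other end sends positions i, i - 1 to m - i, m - i + 1 with m = M + 1,
so inversion replaces the index i by m - i and A_i by -A_i. -/
theorem swapProd_posUp_mul (A A' : ℕ → 𝓐) (α : List ℕ)
    (hα : ∀ i ∈ α, 1 ≤ i ∧ i ≤ M ∧ A' (M + 1 - i) = -A i) :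
    swapProd (posUp M) A' (α.reverse.map fun i => M + 1 - i) * swapProd (posDown M) A α = 1 ∧
      swapProd (posDown M) A α * swapProd (posUp M) A' (α.reverse.map fun i => M + 1 - i) = 1 := by
  induction α with
  | nil => simp [swapProd]
  | cons i α ih =>
    obtain ⟨h1, h2, h3⟩ := hα i (by simp)
    obtain ⟨ih₁, ih₂⟩ := ih fun j hj => hα j (by simp [hj])
    have e1 : posUp M (M + 1 - i) = posDown M (i - 1) := by
      rw [← posUp_sub M (by omega)]
      congr 1
      omega
    have e2 : posUp M (M + 1 - i - 1) = posDown M i := by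
      rw [← posUp_sub M (by omega)]
      congr 1
      omega
    have e3 := swapBlock_mul_swapBlock (posDown_sub_one_ne h1 h2).symm (A i)
    have e4 := swapBlock_mul_swapBlock (posDown_sub_one_ne h1 h2) (-A i)
    rw [neg_neg] at e4
    have e5 : swapProd (posUp M) A' [M + 1 - i] =
        swapBlock (posDown M (i - 1)) (posDown M i) (-A i) := by
      rw [swapProd, List.map_singleton, List.prod_singleton, e1, e2, h3]
    rw [List.reverse_cons, List.map_append, swapProd_append, swapProd_cons, List.map_singleton, e5]
    constructor
    · rw [mul_assoc, ← mul_assoc (swapBlock _ _ _) (swapBlock _ _ _), e4, one_mul, ih₁]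
    · rw [mul_assoc, ← mul_assoc (swapProd _ _ _) (swapProd _ _ _), ih₂, one_mul, e3]

/-- For p ≠ q, the block [0, 1; 1, 0] is a transposition; conjugating by it moves the corner, with
factors independent of z. -/
theorem exists_isUnit_mul_cornerDiag_mul {κ : Type*} [Fintype κ] [DecidableEq κ] (p q : κ) :
    ∃ U V : Matrix κ κ 𝓐, IsUnit U ∧ IsUnit V ∧
      ∀ z : 𝓐, U * cornerDiag p z * V = cornerDiag q z := by
  by_cases h : p = q
  · exact ⟨1, 1, isUnit_one, isUnit_one, fun z => by rw [h, one_mul, mul_one]⟩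
  · have h1 := swapBlock_mul_swapBlock h (0 : 𝓐)
    have h2 := swapBlock_mul_swapBlock (Ne.symm h) (0 : 𝓐)
    rw [neg_zero] at h1 h2
    refine ⟨_, _, isUnit_of_mul_eq_one_and h1 h2, isUnit_of_mul_eq_one_and h2 h1, fun z => ?_⟩
    rw [cornerDiag, mul_add, add_mul, mul_one, h1, swapBlock_mul_single_left h,
      single_mul_swapBlock_right (Ne.symm h), mul_zero, single_zero, add_zero, cornerDiag]

theorem perm_map_sub {α β : List ℕ} (hαβ : (α ++ β).Perm (List.range' 1 M)) :
    (α.reverse.map (fun i => M + 1 - i) ++ β.reverse.map fun i => M + 1 - i).Perm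
      (List.range' 1 M) := by
  rw [← List.map_append]
  refine (List.Perm.map _ (((α.reverse_perm).append (β.reverse_perm)).trans hαβ)).trans ?_
  rw [List.perm_ext_iff_of_nodup _ List.nodup_range']
  · intro a
    simp only [List.mem_map, List.mem_range'_1]
    constructor
    · rintro ⟨i, hi, rfl⟩
      omega
    · intro ha
      exact ⟨M + 1 - a, by omega, by omega⟩
  · refine List.Nodup.map_on (fun x hx y hy h => ?_) List.nodup_range'
    rw [List.mem_range'_1] at hx hy
    omega

omit [Ring 𝓐] [Algebra R 𝓐] in
theorem mul_mul_sub_smul_mul_mul {T : Type*} [Ring T] [Algebra R T] (l : R)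
    {x x' y y' D N K U V U' V' : T} (hx : x' * x = 1) (hy : y * y' = 1)
    (h : U * (l • (x' * N * y') - D) * V = -K) :
    U' * (U * x') * (x * D * y - l • N) * (y' * V * V') = U' * K * V' := by
  have e1 : x' * (x * D * y) * y' = D := by
    rw [mul_assoc, mul_assoc, hy, mul_one, ← mul_assoc, hx, one_mul]
  have e2 : x' * (x * D * y - l • N) * y' = D - l • (x' * N * y') := by
    rw [mul_sub, sub_mul, e1, mul_smul_comm, smul_mul_assoc]
  have e3 : U' * (U * x') * (x * D * y - l • N) * (y' * V * V') =
      U' * (U * (x' * (x * D * y - l • N) * y') * V) * V' := by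
    simp only [mul_assoc]
  rw [e3, e2, ← neg_sub, mul_neg, neg_mul, h, neg_neg]

/-- Linearization property at infinity of the pencils `λ M_{-τ} - M_0`, in terms of the
variable `l = 1 / λ`. -/
theorem exists_isUnit_mul_reversed_fiedler_mul (l : R) (A : ℕ → 𝓐) (g : 𝓐) (α β : List ℕ)
    (hαβ : (α ++ β).Perm (List.range' 1 M)) :
    ∃ U V : Matrix (Fin (M + 1)) (Fin (M + 1)) 𝓐, IsUnit U ∧ IsUnit V ∧
      U * (swapProd (posDown M) A α * partialDiag (posDown M) M (A (M + 1)) *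
          swapProd (posDown M) A β - l • cornerDiag (posDown M 0) (-g)) * V =
        cornerDiag (posDown M 0)
          (∑ j ∈ range (M + 1), l ^ j • A (M + 1 - j) + l ^ (M + 1) • g) := by
  have hmem : ∀ i ∈ α ++ β, 1 ≤ i ∧ i ≤ M ∧
      (fun j => -A (M + 1 - j)) (M + 1 - i) = -A i := fun i hi => by
    have := List.mem_range'_1.1 (hαβ.mem_iff.1 hi)
    refine ⟨by omega, by omega, ?_⟩
    simp only [show M + 1 - (M + 1 - i) = i by omega]
  obtain ⟨hα₁, hα₂⟩ := swapProd_posUp_mul A (fun j => -A (M + 1 - j)) α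
    (fun i hi => hmem i (by simp [hi]))
  obtain ⟨hβ₁, hβ₂⟩ := swapProd_posUp_mul A (fun j => -A (M + 1 - j)) β
    (fun i hi => hmem i (by simp [hi]))
  -- The roles of the two ends are exchanged: A_m becomes the constant corner, and -g becomes the
  -- entry of the coefficient of l. The corner-fixing properties are dropped because at infinity the
  -- coupling is already contained in g.
  obtain ⟨U, V, hU, hV, -, -, h⟩ := exists_isUnit_mul_pencil_mul l (fun j => -A (M + 1 - j)) M
    (posUp_injOn M) (-g) _ _ (perm_map_sub hαβ)
  obtain ⟨U', V', hU', hV', h'⟩ :=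
    exists_isUnit_mul_cornerDiag_mul (𝓐 := 𝓐) (posUp M 0) (posDown M 0)
  have e0 : posUp M 0 = posDown M M := by rw [← posUp_sub M le_rfl, Nat.sub_self]
  have eM : posUp M M = posDown M 0 := by rw [← posUp_sub M (Nat.zero_le _), Nat.sub_zero]
  rw [partialDiag_eq_cornerDiag (posUp_injOn M) (by simp), eM, neg_neg, Nat.sub_zero] at h
  rw [partialDiag_eq_cornerDiag (posDown_injOn M) (by simp), ← e0]
  refine ⟨U' * (U * _), _ * V * V', hU'.mul (hU.mul (isUnit_of_mul_eq_one_and hα₁ hα₂)),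
    ((isUnit_of_mul_eq_one_and hβ₁ hβ₂).mul hV).mul hV', ?_⟩
  rw [mul_mul_sub_smul_mul_mul l hα₁ hβ₂ h, h']
  congr 1
  rw [smul_neg, neg_add, neg_neg, ← sum_neg_distrib]
  simp only [smul_neg, neg_neg]

end Pencils

/-! ### The ring of proper rational functions and its value at infinity -/

section ProperFunctions

open Filter Bornology Topology

/-- The value of a rational function at a point. -/
noncomputable def evalAt (f : RatFunc ℂ) (z : ℂ) : ℂ := f.eval (RingHom.id ℂ) z

theorem eventually_eval₂_ne_zero {p : ℂ[X]} (hp : p ≠ 0) :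
    ∀ᶠ z in cobounded ℂ, p.eval₂ (RingHom.id ℂ) z ≠ 0 := by
  have h : IsBounded {z | p.IsRoot z} := (Polynomial.finite_setOfPred_isRoot hp).isBounded
  filter_upwards [isBounded_def.1 h] with z hz hz'
  exact hz hz'

/-- Evaluation at a pole gives a junk value, so additivity is claimed only away from the finitely
many zeros of the denominators. -/
theorem eventually_evalAt_add (f g : RatFunc ℂ) :
    ∀ᶠ z in cobounded ℂ, evalAt (f + g) z = evalAt f z + evalAt g z := by
  filter_upwards [eventually_eval₂_ne_zero f.denom_ne_zero,
    eventually_eval₂_ne_zero g.denom_ne_zero] with z hf hg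
  exact RatFunc.eval_add _ _ hf hg

theorem eventually_evalAt_mul (f g : RatFunc ℂ) :
    ∀ᶠ z in cobounded ℂ, evalAt (f * g) z = evalAt f z * evalAt g z := by
  filter_upwards [eventually_eval₂_ne_zero f.denom_ne_zero,
    eventually_eval₂_ne_zero g.denom_ne_zero] with z hf hg
  exact RatFunc.eval_mul _ _ hf hg

theorem evalAt_C (c z : ℂ) : evalAt (RatFunc.C c) z = c := by
  simp [evalAt]

theorem eventually_evalAt_inv {f : RatFunc ℂ} (hf : f ≠ 0) :
    ∀ᶠ z in cobounded ℂ, evalAt f⁻¹ z = (evalAt f z)⁻¹ := by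
  filter_upwards [eventually_evalAt_mul f f⁻¹] with z hz
  rw [mul_inv_cancel₀ hf, ← map_one (RatFunc.C (K := ℂ)), evalAt_C] at hz
  exact (inv_eq_of_mul_eq_one_right hz.symm).symm

/-- `f` has the limit `c` at infinity. -/
def HasLimit (f : RatFunc ℂ) (c : ℂ) : Prop := Tendsto (evalAt f) (cobounded ℂ) (𝓝 c)

theorem HasLimit.add {f g : RatFunc ℂ} {c d : ℂ} (hf : HasLimit f c) (hg : HasLimit g d) :
    HasLimit (f + g) (c + d) :=
  (Tendsto.add hf hg).congr' ((eventually_evalAt_add f g).mono fun _ h => h.symm)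

theorem HasLimit.mul {f g : RatFunc ℂ} {c d : ℂ} (hf : HasLimit f c) (hg : HasLimit g d) :
    HasLimit (f * g) (c * d) :=
  (Tendsto.mul hf hg).congr' ((eventually_evalAt_mul f g).mono fun _ h => h.symm)

theorem hasLimit_C (c : ℂ) : HasLimit (RatFunc.C c) c :=
  tendsto_const_nhds.congr fun z => (evalAt_C c z).symm

theorem hasLimit_zero : HasLimit 0 0 := by simpa using hasLimit_C 0

theorem hasLimit_one : HasLimit 1 1 := by simpa using hasLimit_C 1

theorem hasLimit_X_inv : HasLimit (RatFunc.X)⁻¹ 0 := by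
  refine tendsto_inv₀_cobounded.congr' ?_
  filter_upwards [eventually_evalAt_inv (RatFunc.X_ne_zero (K := ℂ))] with z hz
  rw [hz, evalAt, RatFunc.eval_X]

theorem HasLimit.inv {f : RatFunc ℂ} {c : ℂ} (hf : HasLimit f c) (hc : c ≠ 0) :
    HasLimit f⁻¹ c⁻¹ := by
  have h0 : f ≠ 0 := by
    rintro rfl
    refine hc (tendsto_nhds_unique hf hasLimit_zero)
  exact (Tendsto.inv₀ hf hc).congr' ((eventually_evalAt_inv h0).mono fun _ h => h.symm)

/-- The ring of proper rational functions, those which have a limit at infinity. -/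
def properSubring : Subring (RatFunc ℂ) where
  carrier := {f | ∃ c, HasLimit f c}
  mul_mem' := fun ⟨_, hf⟩ ⟨_, hg⟩ => ⟨_, hf.mul hg⟩
  one_mem' := ⟨1, hasLimit_one⟩
  add_mem' := fun ⟨_, hf⟩ ⟨_, hg⟩ => ⟨_, hf.add hg⟩
  zero_mem' := ⟨0, hasLimit_zero⟩
  neg_mem' := fun {f} ⟨c, hf⟩ => ⟨-1 * c, by simpa using (hasLimit_C (-1)).mul hf⟩

/-- The value at infinity of a proper rational function. -/
noncomputable def valueAtInfinity : properSubring →+* ℂ where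
  toFun f := f.2.choose
  map_one' := tendsto_nhds_unique (Exists.choose_spec (1 : properSubring).2)
    hasLimit_one
  map_mul' f g := tendsto_nhds_unique (f * g).2.choose_spec
    (HasLimit.mul f.2.choose_spec g.2.choose_spec)
  map_zero' := tendsto_nhds_unique (Exists.choose_spec (0 : properSubring).2)
    hasLimit_zero
  map_add' f g := tendsto_nhds_unique (f + g).2.choose_spec
    (HasLimit.add f.2.choose_spec g.2.choose_spec)

theorem hasLimit_valueAtInfinity (f : properSubring) :
    HasLimit f (valueAtInfinity f) := f.2.choose_spec

theorem valueAtInfinity_eq {f : properSubring} {c : ℂ} (h : HasLimit f c) :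
    valueAtInfinity f = c :=
  tendsto_nhds_unique (hasLimit_valueAtInfinity f) h

theorem isUnit_of_valueAtInfinity_ne_zero {f : properSubring} (h : valueAtInfinity f ≠ 0) :
    IsUnit f := by
  have h0 : (f : RatFunc ℂ) ≠ 0 := fun h0 => h (by
    rw [show f = 0 from Subtype.ext h0, map_zero])
  refine IsUnit.of_mul_eq_one ⟨(f : RatFunc ℂ)⁻¹, _, (hasLimit_valueAtInfinity f).inv h⟩
    (Subtype.ext ?_)
  exact mul_inv_cancel₀ h0

/-- Constants as proper rational functions. -/
noncomputable def properConst : ℂ →+* properSubring :=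
  (RatFunc.C (K := ℂ)).codRestrict properSubring fun c => ⟨c, hasLimit_C c⟩

theorem valueAtInfinity_properConst (c : ℂ) : valueAtInfinity (properConst c) = c :=
  valueAtInfinity_eq (hasLimit_C c)

/-- `1 / λ` as a proper rational function. -/
noncomputable def properXInv : properSubring := ⟨(RatFunc.X)⁻¹, 0, hasLimit_X_inv⟩

theorem valueAtInfinity_properXInv : valueAtInfinity properXInv = 0 :=
  valueAtInfinity_eq hasLimit_X_inv

variable {ι : Type*} [Fintype ι] [DecidableEq ι]

theorem isBiproper_map_of_isUnit {F : Matrix ι ι properSubring} (hF : IsUnit F) :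
    IsBiproper (F.map properSubring.subtype) := by
  refine ⟨F.map valueAtInfinity, ?_, ?_⟩
  · exact (isUnit_iff_isUnit_det _).1 (hF.map valueAtInfinity.mapMatrix)
  · refine tendsto_pi_nhds.2 fun i => tendsto_pi_nhds.2 fun j => ?_
    exact hasLimit_valueAtInfinity (F i j)

/-- The inverse of a pencil `λ E - A` with `E` nonsingular is proper. -/
theorem exists_proper_pencil_inv (E A : Matrix ι ι ℂ) (hE : IsUnit E.det) :
    ∃ Y : Matrix ι ι properSubring,
      ((RatFunc.X : RatFunc ℂ) • E.map RatFunc.C - A.map RatFunc.C) *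
        Y.map properSubring.subtype = 1 := by
  -- Factor λE - A = λ(E - λ⁻¹A). The second factor has the value E at infinity, so it is invertible
  -- over the proper functions.
  set W : Matrix ι ι properSubring := E.map properConst - properXInv • A.map properConst with hW
  have hdet : IsUnit W.det := by
    apply isUnit_of_valueAtInfinity_ne_zero
    rw [RingHom.map_det]
    have : valueAtInfinity.mapMatrix W = E := by
      ext i j
      simp [hW, valueAtInfinity_properConst, valueAtInfinity_properXInv]
    rw [this]
    exact hE.ne_zero
  refine ⟨properXInv • W⁻¹, ?_⟩
  have e1 : (RatFunc.X : RatFunc ℂ) • E.map RatFunc.C - A.map RatFunc.C =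
      (RatFunc.X : RatFunc ℂ) • properSubring.subtype.mapMatrix W := by
    ext i j
    simp only [hW, Matrix.sub_apply, Matrix.smul_apply, map_apply, RingHom.mapMatrix_apply,
      smul_eq_mul, map_sub, map_mul, mul_sub]
    congr 1
    change _ = RatFunc.X * ((RatFunc.X)⁻¹ * RatFunc.C (A i j))
    rw [mul_inv_cancel_left₀ RatFunc.X_ne_zero]
  have e2 : (properXInv • W⁻¹).map properSubring.subtype =
      (RatFunc.X : RatFunc ℂ)⁻¹ • properSubring.subtype.mapMatrix W⁻¹ := by
    ext i j
    rfl
  rw [e1, e2, smul_mul_smul_comm, mul_inv_cancel₀ RatFunc.X_ne_zero, one_smul, ← map_mul,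
    mul_nonsing_inv _ hdet, map_one]

end ProperFunctions

/-! ### Division by a pencil and invariance of minimality -/

section Division

variable {ι : Type*} [Fintype ι] [DecidableEq ι] {r : ℕ}

/-- Division of polynomial matrices by a pencil on the right. -/
theorem exists_eq_mul_pencil_add (E A : Matrix (Fin r) (Fin r) ℂ) (hE : IsUnit E.det)
    (N : Matrix ι (Fin r) ℂ[X]) :
    ∃ (Q : Matrix ι (Fin r) ℂ[X]) (D : Matrix ι (Fin r) ℂ),
      N = Q * ((X : ℂ[X]) • E.map Polynomial.C - A.map Polynomial.C) + D.map Polynomial.C := by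
  have hmap : ∀ {k l m : Type _} [Fintype l] (Y : Matrix k l ℂ) (Y' : Matrix l m ℂ),
      (Y * Y').map Polynomial.C = Y.map Polynomial.C * Y'.map Polynomial.C :=
    fun Y Y' => Matrix.map_mul
  have hadd : ∀ N N' : Matrix ι (Fin r) ℂ[X],
      (∃ (Q : Matrix ι (Fin r) ℂ[X]) (D : Matrix ι (Fin r) ℂ),
        N = Q * ((X : ℂ[X]) • E.map Polynomial.C - A.map Polynomial.C) + D.map Polynomial.C) →
      (∃ (Q : Matrix ι (Fin r) ℂ[X]) (D : Matrix ι (Fin r) ℂ),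
        N' = Q * ((X : ℂ[X]) • E.map Polynomial.C - A.map Polynomial.C) + D.map Polynomial.C) →
      ∃ (Q : Matrix ι (Fin r) ℂ[X]) (D : Matrix ι (Fin r) ℂ),
        N + N' = Q * ((X : ℂ[X]) • E.map Polynomial.C - A.map Polynomial.C) +
          D.map Polynomial.C := by
    rintro _ _ ⟨Q, D, rfl⟩ ⟨Q', D', rfl⟩
    refine ⟨Q + Q', D + D', ?_⟩
    rw [Matrix.add_mul, Matrix.map_add _ (map_add Polynomial.C)]
    abel
  induction N using Matrix.induction_on' with
  | h_zero => exact ⟨0, 0, by simp⟩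
  | h_add p q hp hq => exact hadd p q hp hq
  | h_std_basis i j p =>
    induction p using Polynomial.induction_on with
    | C a =>
      refine ⟨0, single i j a, ?_⟩
      rw [Matrix.zero_mul, zero_add, map_single]
    | add p q hp hq =>
      rw [single_add]
      exact hadd _ _ hp hq
    | monomial k a h =>
      obtain ⟨Q, D, h⟩ := h
      -- The remainder is divided again using λD = DE⁻¹(λE - A) + DE⁻¹A.
      refine ⟨(X : ℂ[X]) • Q + (D * E⁻¹).map Polynomial.C, D * E⁻¹ * A, ?_⟩
      have e : single i j (Polynomial.C a * X ^ (k + 1)) =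
          (X : ℂ[X]) • single i j (Polynomial.C a * X ^ k) := by
        rw [smul_single, smul_eq_mul, pow_succ]
        congr 1
        ring
      have e2 : (D * E⁻¹).map Polynomial.C * E.map Polynomial.C = D.map Polynomial.C := by
        rw [← hmap, nonsing_inv_mul_cancel_right _ _ hE]
      rw [e, h, smul_add, Matrix.add_mul, Matrix.mul_sub ((D * E⁻¹).map _), Matrix.mul_smul, e2,
        hmap (D * E⁻¹) A, Matrix.smul_mul]
      abel

/-- Division of polynomial matrices by a pencil on the left. -/
theorem exists_eq_pencil_mul_add (E A : Matrix (Fin r) (Fin r) ℂ) (hE : IsUnit E.det)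
    (N : Matrix (Fin r) ι ℂ[X]) :
    ∃ (Q : Matrix (Fin r) ι ℂ[X]) (D : Matrix (Fin r) ι ℂ),
      N = ((X : ℂ[X]) • E.map Polynomial.C - A.map Polynomial.C) * Q + D.map Polynomial.C := by
  obtain ⟨Q, D, h⟩ := exists_eq_mul_pencil_add Eᵀ Aᵀ (by rwa [det_transpose]) Nᵀ
  refine ⟨Qᵀ, Dᵀ, ?_⟩
  rw [← transpose_transpose N, h, transpose_add, transpose_mul]
  rfl

theorem map_pencil (E A : Matrix (Fin r) (Fin r) ℂ) :
    ((X : ℂ[X]) • E.map Polynomial.C - A.map Polynomial.C).map (algebraMap ℂ[X] (RatFunc ℂ)) =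
      (RatFunc.X : RatFunc ℂ) • E.map RatFunc.C - A.map RatFunc.C := by
  ext i j
  simp only [map_apply, Matrix.sub_apply, Matrix.smul_apply, smul_eq_mul, map_sub, map_mul,
    RatFunc.algebraMap_X, RatFunc.algebraMap_C]

theorem map_map_C {k l : Type*} (Y : Matrix k l ℂ) :
    (Y.map Polynomial.C).map (algebraMap ℂ[X] (RatFunc ℂ)) = Y.map RatFunc.C := by
  ext i j
  simp [RatFunc.algebraMap_C]

theorem map_neg_C {k l : Type*} (Y : Matrix k l ℂ) :
    (-Y).map Polynomial.C = -Y.map Polynomial.C := by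
  ext i j
  simp

theorem pencil_mul_inv (E A : Matrix (Fin r) (Fin r) ℂ) (hE : IsUnit E.det) :
    ((RatFunc.X : RatFunc ℂ) • E.map RatFunc.C - A.map RatFunc.C) *
      ((RatFunc.X : RatFunc ℂ) • E.map RatFunc.C - A.map RatFunc.C)⁻¹ = 1 := by
  obtain ⟨Y, hY⟩ := exists_proper_pencil_inv E A hE
  rw [inv_eq_right_inv hY, hY]

/-- If `F(λ)` has a realization of size `r`, then so does `U(λ) F(λ) V(λ)`, for all matrix
polynomials `U(λ)` and `V(λ)`. -/
theorem exists_realization_mul_mul {κ : Type*} [Fintype κ] [DecidableEq κ] (S : Realization κ r)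
    (U : Matrix ι κ ℂ[X]) (V : Matrix κ ι ℂ[X]) :
    ∃ T : Realization ι r, T.transferFunction =
      U.map (algebraMap ℂ[X] (RatFunc ℂ)) * S.transferFunction *
        V.map (algebraMap ℂ[X] (RatFunc ℂ)) := by
  obtain ⟨Q₁, C₁, h₁⟩ := exists_eq_mul_pencil_add S.E S.A S.nonsingular
    (U * S.C.map Polynomial.C)
  obtain ⟨Q₂, B₂, h₂⟩ := exists_eq_pencil_mul_add S.E S.A S.nonsingular
    (S.B.map Polynomial.C * V)
  -- With Z = λE - A, UC = Q₁Z + C₁ and BV = ZQ₂ + B₂, one gets UCZ⁻¹BV = Q₁BV + C₁Q₂ + C₁Z⁻¹B₂.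
  -- Only the polynomial part and the constant couplings change.
  refine ⟨⟨U * S.P * V + Q₁ * S.B.map Polynomial.C * V + C₁.map Polynomial.C * Q₂, C₁, S.E, S.A,
    B₂, S.nonsingular⟩, ?_⟩
  have h₁' := congrArg (fun Y => Y.map (algebraMap ℂ[X] (RatFunc ℂ))) h₁
  have h₂' := congrArg (fun Y => Y.map (algebraMap ℂ[X] (RatFunc ℂ))) h₂
  simp only [Matrix.map_add _ (map_add (algebraMap ℂ[X] (RatFunc ℂ))), Matrix.map_mul, map_pencil,
    map_map_C] at h₁' h₂'
  have hZ := pencil_mul_inv S.E S.A S.nonsingular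
  have hZ' := mul_eq_one_comm.1 hZ
  simp only [Realization.transferFunction,
    Matrix.map_add _ (map_add (algebraMap ℂ[X] (RatFunc ℂ))), Matrix.map_mul, map_map_C]
  generalize (RatFunc.X : RatFunc ℂ) • S.E.map RatFunc.C - S.A.map RatFunc.C = Z at *
  generalize U.map (algebraMap ℂ[X] (RatFunc ℂ)) = u at *
  generalize V.map (algebraMap ℂ[X] (RatFunc ℂ)) = v at *
  generalize S.P.map (algebraMap ℂ[X] (RatFunc ℂ)) = p at *
  generalize Q₁.map (algebraMap ℂ[X] (RatFunc ℂ)) = q₁ at *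
  generalize Q₂.map (algebraMap ℂ[X] (RatFunc ℂ)) = q₂ at *
  generalize S.C.map RatFunc.C = c at *
  generalize S.B.map RatFunc.C = b at *
  generalize C₁.map RatFunc.C = c₁ at *
  generalize B₂.map RatFunc.C = b₂ at *
  have e : u * (p + c * Z⁻¹ * b) * v = u * p * v + u * c * Z⁻¹ * (b * v) := by
    simp only [Matrix.mul_add, Matrix.add_mul, Matrix.mul_assoc]
  have e1 : q₁ * Z * Z⁻¹ = q₁ := by rw [Matrix.mul_assoc, hZ, Matrix.mul_one]
  have e2 : Z⁻¹ * (Z * q₂) = q₂ := by rw [← Matrix.mul_assoc, hZ', Matrix.one_mul]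
  rw [e, h₁', Matrix.add_mul, Matrix.add_mul, e1, h₂', Matrix.mul_add (c₁ * Z⁻¹),
    Matrix.mul_assoc c₁ Z⁻¹ (Z * q₂), e2, ← h₂', ← Matrix.mul_assoc q₁]
  abel

theorem isMinimal_of_mul_mul {κ : Type*} [Fintype κ] [DecidableEq κ] {S : Realization ι r}
    (hS : S.IsMinimal) {T : Realization κ r} {U : Matrix ι κ ℂ[X]} {V : Matrix κ ι ℂ[X]}
    (h : U.map (algebraMap ℂ[X] (RatFunc ℂ)) * T.transferFunction *
      V.map (algebraMap ℂ[X] (RatFunc ℂ)) = S.transferFunction) : T.IsMinimal := by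
  intro r' T' hT'
  obtain ⟨S', hS'⟩ := exists_realization_mul_mul T' U V
  exact hS r' S' (by rw [hS', hT', h])

end Division

/-! ### Constant block diagonal equivalence of realizations -/

section ConstantEquivalence

variable {M n r : ℕ} (S : Realization (Fin n) r)

/-- The system matrix of `diag(Φ₁, R₁) (λ diag(W, -E) - M_0) diag(Φ₂, R₂)`. -/
noncomputable def equivalentRealization (S : Realization (Fin n) r)
    (W Φ₁ Φ₂ : Matrix (Fin (M + 1) × Fin n) (Fin (M + 1) × Fin n) ℂ)
    (R₁ R₂ : Matrix (Fin r) (Fin r) ℂ) (h₁ : IsUnit R₁) (h₂ : IsUnit R₂) :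
    Realization (Fin (M + 1) × Fin n) r where
  P := Φ₁.map Polynomial.C * ((X : ℂ[X]) • W.map Polynomial.C -
    (lastDiag (M + 1) (-S.coeff 0)).map Polynomial.C) * Φ₂.map Polynomial.C
  C := Φ₁ * lastCol (M + 1) S.C * R₂
  E := R₁ * S.E * R₂
  A := R₁ * S.A * R₂
  B := R₁ * lastRow (M + 1) S.B * Φ₂
  nonsingular := by
    rw [det_mul, det_mul]
    exact (((isUnit_iff_isUnit_det _).1 h₁).mul S.nonsingular).mul ((isUnit_iff_isUnit_det _).1 h₂)

variable (W Φ₁ Φ₂ : Matrix (Fin (M + 1) × Fin n) (Fin (M + 1) × Fin n) ℂ)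
  (R₁ R₂ : Matrix (Fin r) (Fin r) ℂ) (h₁ : IsUnit R₁) (h₂ : IsUnit R₂)

theorem systemMatrix_equivalentRealization_eq :
    (equivalentRealization S W Φ₁ Φ₂ R₁ R₂ h₁ h₂).systemMatrix =
      fromBlocks (Φ₁.map Polynomial.C) 0 0 (R₁.map Polynomial.C) *
        fromBlocks ((X : ℂ[X]) • W.map Polynomial.C -
            (lastDiag (M + 1) (-S.coeff 0)).map Polynomial.C)
          (lastCol (M + 1) (S.C.map Polynomial.C)) (lastRow (M + 1) (S.B.map Polynomial.C))
          (S.A.map Polynomial.C - (X : ℂ[X]) • S.E.map Polynomial.C) *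
        fromBlocks (Φ₂.map Polynomial.C) 0 0 (R₂.map Polynomial.C) := by
  have e : R₁.map Polynomial.C * S.A.map Polynomial.C * R₂.map Polynomial.C -
      (X : ℂ[X]) • (R₁.map Polynomial.C * S.E.map Polynomial.C * R₂.map Polynomial.C) =
      R₁.map Polynomial.C * (S.A.map Polynomial.C - (X : ℂ[X]) • S.E.map Polynomial.C) *
        R₂.map Polynomial.C := by
    simp only [Matrix.mul_sub, Matrix.sub_mul, Matrix.mul_smul, Matrix.smul_mul]
  rw [Realization.systemMatrix, fromBlocks_multiply, fromBlocks_multiply]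
  simp only [equivalentRealization, Matrix.map_mul, map_lastCol, map_lastRow, e, Matrix.zero_mul,
    Matrix.mul_zero, add_zero, zero_add]

theorem systemMatrix_equivalentRealization :
    (equivalentRealization S W Φ₁ Φ₂ R₁ R₂ h₁ h₂).systemMatrix =
      (X : ℂ[X]) • (fromBlocks Φ₁ 0 0 R₁ * fromBlocks W 0 0 (-S.E) *
          fromBlocks Φ₂ 0 0 R₂).map Polynomial.C -
        (fromBlocks Φ₁ 0 0 R₁ * fiedlerZero (M + 1) S *
          fromBlocks Φ₂ 0 0 R₂).map Polynomial.C := by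
  have e : fromBlocks ((X : ℂ[X]) • W.map Polynomial.C -
      (lastDiag (M + 1) (-S.coeff 0)).map Polynomial.C)
      (lastCol (M + 1) (S.C.map Polynomial.C)) (lastRow (M + 1) (S.B.map Polynomial.C))
      (S.A.map Polynomial.C - (X : ℂ[X]) • S.E.map Polynomial.C) =
      (X : ℂ[X]) • (fromBlocks W 0 0 (-S.E)).map Polynomial.C -
        (fiedlerZero (M + 1) S).map Polynomial.C := by
    rw [fiedlerZero, fromBlocks_map, fromBlocks_map, fromBlocks_smul, sub_eq_add_neg,
      sub_eq_add_neg, sub_eq_add_neg, fromBlocks_neg, fromBlocks_add]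
    simp [map_neg_C, map_lastCol, map_lastRow, add_comm]
  rw [systemMatrix_equivalentRealization_eq, e]
  simp only [Matrix.map_mul, Matrix.mul_sub, Matrix.sub_mul, Matrix.mul_smul, Matrix.smul_mul,
    fromBlocks_map, Matrix.map_zero _ (map_zero Polynomial.C)]

theorem map_pencil_lastDiag :
    ((X : ℂ[X]) • W.map Polynomial.C -
      (lastDiag (M + 1) (-S.coeff 0)).map Polynomial.C).map (algebraMap ℂ[X] (RatFunc ℂ)) =
      (RatFunc.X : RatFunc ℂ) • W.map RatFunc.C -
        lastDiag (M + 1) (-(S.coeff 0).map RatFunc.C) := by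
  have h : -(S.coeff 0).map RatFunc.C = (-S.coeff 0).map RatFunc.C := by ext i j; simp
  rw [h, ← map_lastDiag]
  ext i j
  simp only [map_apply, Matrix.sub_apply, Matrix.smul_apply, smul_eq_mul, map_sub, map_mul,
    RatFunc.algebraMap_X, RatFunc.algebraMap_C]

theorem transferFunction_equivalentRealization :
    (equivalentRealization S W Φ₁ Φ₂ R₁ R₂ h₁ h₂).transferFunction =
      Φ₁.map RatFunc.C * ((RatFunc.X : RatFunc ℂ) • W.map RatFunc.C -
        lastDiag (M + 1) (-(S.coeff 0).map RatFunc.C) + lastCol (M + 1) (S.C.map RatFunc.C) *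
          ((RatFunc.X : RatFunc ℂ) • S.E.map RatFunc.C - S.A.map RatFunc.C)⁻¹ *
            lastRow (M + 1) (S.B.map RatFunc.C)) * Φ₂.map RatFunc.C := by
  have hR₁ : IsUnit (R₁.map RatFunc.C).det :=
    (isUnit_iff_isUnit_det _).1 (h₁.map (RatFunc.C (K := ℂ)).mapMatrix)
  have hR₂ : IsUnit (R₂.map RatFunc.C).det :=
    (isUnit_iff_isUnit_det _).1 (h₂.map (RatFunc.C (K := ℂ)).mapMatrix)
  have e : (RatFunc.X : RatFunc ℂ) •
        (R₁.map RatFunc.C * S.E.map RatFunc.C * R₂.map RatFunc.C) -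
      R₁.map RatFunc.C * S.A.map RatFunc.C * R₂.map RatFunc.C = R₁.map RatFunc.C *
        ((RatFunc.X : RatFunc ℂ) • S.E.map RatFunc.C - S.A.map RatFunc.C) *
          R₂.map RatFunc.C := by
    simp only [Matrix.mul_sub, Matrix.sub_mul, Matrix.mul_smul, Matrix.smul_mul]
  simp only [Realization.transferFunction, equivalentRealization, Matrix.map_mul, map_map_C,
    map_pencil_lastDiag]
  rw [e, Matrix.mul_inv_rev, Matrix.mul_inv_rev]
  simp only [map_lastCol, map_lastRow, Matrix.mul_add, Matrix.add_mul,
    Matrix.mul_assoc]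
  congr 3
  rw [mul_nonsing_inv_cancel_left _ _ hR₂, nonsing_inv_mul_cancel_left _ _ hR₁]

end ConstantEquivalence

/-! ### Strict system equivalence, structure at infinity, irreducibility -/

section Linearization

variable {M n r : ℕ}

theorem flatten_map {R R' : Type*} [CommRing R] [CommRing R'] (f : R →+* R')
    (Y : Matrix (Fin (M + 1)) (Fin (M + 1)) (Matrix (Fin n) (Fin n) R)) :
    (flatten M n R Y).map f = flatten M n R' (Y.map f.mapMatrix) := rfl

theorem flatten_smul {R : Type*} [CommRing R] (c : R)
    (Y : Matrix (Fin (M + 1)) (Fin (M + 1)) (Matrix (Fin n) (Fin n) R)) :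
    flatten M n R (c • Y) = c • flatten M n R Y := rfl

theorem map_leadingBlock {R : Type*} [CommRing R] (f : ℂ →+* R) (S : Realization (Fin n) r)
    (α β : List ℕ) :
    (leadingBlock M S α β).map f.mapMatrix =
      swapProd (posDown M) (fun j => f.mapMatrix (S.coeff j)) α *
        partialDiag (posDown M) M (f.mapMatrix (S.coeff (M + 1))) *
          swapProd (posDown M) (fun j => f.mapMatrix (S.coeff j)) β := by
  rw [leadingBlock, partialDiag_eq_cornerDiag (posDown_injOn M) (by simp),
    partialDiag_eq_cornerDiag (posDown_injOn M) (by simp), Matrix.map_mul, Matrix.map_mul,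
    map_swapProd, map_swapProd, map_cornerDiag]

theorem eq_sum_coeff (S : Realization (Fin n) r) {m : ℕ} (hdeg : ∀ a b, (S.P a b).natDegree ≤ m) :
    S.P = ∑ j ∈ range (m + 1), (X : ℂ[X]) ^ j • (S.coeff j).map Polynomial.C := by
  ext1 a b
  rw [Matrix.sum_apply]
  conv_lhs => rw [as_sum_range_C_mul_X_pow' (S.P a b) (Nat.lt_succ_of_le (hdeg a b))]
  refine sum_congr rfl fun j _ => ?_
  simp only [Matrix.smul_apply, map_apply, Realization.coeff, smul_eq_mul, mul_comm]

theorem lastRow_mul_lastDiag_mul_lastCol {R : Type*} [CommRing R] (Z : Matrix (Fin n) (Fin n) R) :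
    lastRow (M + 1) (1 : Matrix (Fin n) (Fin n) R) * lastDiag (M + 1) Z *
      lastCol (M + 1) (1 : Matrix (Fin n) (Fin n) R) = Z := by
  have h1 : lastRow (M + 1) (1 : Matrix (Fin n) (Fin n) R) * lastDiag (M + 1) Z =
      lastRow (M + 1) Z := by
    ext a ⟨j, b⟩
    simp only [mul_apply, Fintype.sum_prod_type, lastRow, lastDiag, of_apply]
    rw [sum_eq_single_of_mem j (mem_univ _)]
    · by_cases h : (j : ℕ) = M
      · simp [h, one_apply]
      · simp [h]
    · intro i _ hi
      simp [hi]
  rw [h1]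
  ext a b
  simp only [mul_apply, Fintype.sum_prod_type, lastRow, lastCol, of_apply]
  rw [sum_eq_single_of_mem (Fin.last M) (mem_univ _)]
  · simp [one_apply]
  · intro i _ hi
    have : (i : ℕ) ≠ M := fun h => hi (Fin.ext h)
    simp [this]

theorem isUnimodular_of_isUnit {ι : Type*} [Fintype ι] [DecidableEq ι] {U : Matrix ι ι ℂ[X]}
    (hU : IsUnit U) : IsUnimodular U := by
  obtain ⟨c, hc, h⟩ := Polynomial.isUnit_iff.1 ((isUnit_iff_isUnit_det _).1 hU)
  exact ⟨c, hc.ne_zero, h.symm⟩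

/-- The finite eigenstructure: `U(λ)` and `V(λ)` also preserve the coupling with the state
space part. -/
theorem exists_isUnit_mul_pencil_eq_lastDiag (S : Realization (Fin n) r)
    (hdeg : ∀ a b, (S.P a b).natDegree ≤ M + 1) (α β : List ℕ)
    (hαβ : (α ++ β).Perm (List.range' 1 M)) :
    ∃ U V : Matrix (Fin (M + 1) × Fin n) (Fin (M + 1) × Fin n) ℂ[X], IsUnit U ∧ IsUnit V ∧
      (∀ Z : Matrix (Fin n) (Fin r) ℂ[X], U * lastCol (M + 1) Z = lastCol (M + 1) Z) ∧
      (∀ Z : Matrix (Fin r) (Fin n) ℂ[X], lastRow (M + 1) Z * V = lastRow (M + 1) Z) ∧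
      U * ((X : ℂ[X]) • (flatten M n ℂ (leadingBlock M S α β)).map Polynomial.C -
        (lastDiag (M + 1) (-S.coeff 0)).map Polynomial.C) * V = lastDiag (M + 1) S.P := by
  obtain ⟨U, V, hU, hV, hU', hV', h⟩ := exists_isUnit_mul_fiedler_mul (X : ℂ[X])
    (fun j => (Polynomial.C : ℂ →+* ℂ[X]).mapMatrix (S.coeff j)) α β hαβ
  refine ⟨flatten M n _ U, flatten M n _ V, hU.map _, hV.map _, fun Z => ?_, fun Z => ?_, ?_⟩
  · rw [← lastCol_eq_mul, ← Matrix.mul_assoc, ← map_mul, hU']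
  · rw [← lastRow_eq_mul, Matrix.mul_assoc, ← map_mul, hV']
  · rw [flatten_map, map_leadingBlock, map_lastDiag, map_neg_C, lastDiag_eq, ← flatten_smul,
      ← map_sub, ← map_mul, ← map_mul, lastDiag_eq, eq_sum_coeff S hdeg]
    exact congrArg _ h

/-- Division by λ^m reverses the coefficients of P and makes it a polynomial in 1/λ; the matrix `g`
joins A_0 in the term of degree m. -/
theorem transferFunction_eq_sum (S : Realization (Fin n) r)
    (hdeg : ∀ a b, (S.P a b).natDegree ≤ M + 1) (g : Matrix (Fin n) (Fin n) (RatFunc ℂ)) :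
    ∑ j ∈ range (M + 1), (RatFunc.X : RatFunc ℂ)⁻¹ ^ j • (S.coeff (M + 1 - j)).map RatFunc.C +
      (RatFunc.X : RatFunc ℂ)⁻¹ ^ (M + 1) • ((S.coeff 0).map RatFunc.C + g) =
    ((RatFunc.X : RatFunc ℂ) ^ (M + 1))⁻¹ • (S.P.map (algebraMap ℂ[X] (RatFunc ℂ)) + g) := by
  have hP : S.P.map (algebraMap ℂ[X] (RatFunc ℂ)) =
      ∑ j ∈ range (M + 1 + 1), (RatFunc.X : RatFunc ℂ) ^ j • (S.coeff j).map RatFunc.C := by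
    conv_lhs => rw [eq_sum_coeff S hdeg]
    ext a b
    simp only [map_apply, Matrix.sum_apply, Matrix.smul_apply, smul_eq_mul, map_sum, map_mul,
      map_pow, RatFunc.algebraMap_X, RatFunc.algebraMap_C]
  rw [sum_range_succ', pow_zero, one_smul] at hP
  rw [hP, add_assoc, ← inv_pow, smul_add _ (Finset.sum _ _), smul_sum, ← sum_range_reflect]
  congr 1
  refine sum_congr rfl fun j hj => ?_
  have hj := mem_range.1 hj
  rw [smul_smul]
  congr 1
  · rw [show M + 1 = (M + 1 - 1 - j) + (j + 1) by omega, pow_add, mul_assoc, ← mul_pow,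
      inv_mul_cancel₀ RatFunc.X_ne_zero, one_pow, mul_one]
    congr 1
    omega
  · congr 2
    omega

/-- The structure at infinity. -/
theorem exists_isBiproper_mul_mul (S : Realization (Fin n) r)
    (hdeg : ∀ a b, (S.P a b).natDegree ≤ M + 1) (α β : List ℕ)
    (hαβ : (α ++ β).Perm (List.range' 1 M))
    {Φ₁ Φ₂ : Matrix (Fin (M + 1) × Fin n) (Fin (M + 1) × Fin n) ℂ}
    (hΦ₁ : IsUnit Φ₁) (hΦ₂ : IsUnit Φ₂)
    {R₁ R₂ : Matrix (Fin r) (Fin r) ℂ} (h₁ : IsUnit R₁) (h₂ : IsUnit R₂) :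
    ∃ Oℓ Oᵣ : Matrix (Fin (M + 1) × Fin n) (Fin (M + 1) × Fin n) (RatFunc ℂ),
      IsBiproper Oℓ ∧ IsBiproper Oᵣ ∧
      Oℓ * ((RatFunc.X : RatFunc ℂ)⁻¹ • (equivalentRealization S
        (flatten M n ℂ (leadingBlock M S α β)) Φ₁ Φ₂ R₁ R₂ h₁ h₂).transferFunction) * Oᵣ =
          lastDiag (M + 1) (((RatFunc.X : RatFunc ℂ) ^ (M + 1))⁻¹ • S.transferFunction) := by
  obtain ⟨Y, hY⟩ := exists_proper_pencil_inv S.E S.A S.nonsingular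
  -- This is C(λE - A)⁻¹B over the proper functions, so the elimination may treat A_0 + g as a
  -- single coefficient.
  set g : Matrix (Fin n) (Fin n) properSubring :=
    S.C.map properConst * Y * S.B.map properConst with hg
  obtain ⟨U, V, hU, hV, h⟩ := exists_isUnit_mul_reversed_fiedler_mul properXInv
    (fun j => properConst.mapMatrix (S.coeff j)) (properConst.mapMatrix (S.coeff 0) + g) α β hαβ
  obtain ⟨Ψ₁, hΨ₁⟩ := hΦ₁.exists_left_inv
  obtain ⟨Ψ₂, hΨ₂⟩ := hΦ₂.exists_right_inv
  have hΨ₁' : IsUnit Ψ₁ := isUnit_of_mul_eq_one_and hΨ₁ (mul_eq_one_comm.1 hΨ₁)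
  have hΨ₂' : IsUnit Ψ₂ := isUnit_of_mul_eq_one_and (mul_eq_one_comm.1 hΨ₂) hΨ₂
  refine ⟨(flatten M n _ U * properConst.mapMatrix Ψ₁).map properSubring.subtype,
    (properConst.mapMatrix Ψ₂ * flatten M n _ V).map properSubring.subtype,
    isBiproper_map_of_isUnit ((hU.map (flatten M n properSubring)).mul (hΨ₁'.map _)),
    isBiproper_map_of_isUnit ((hΨ₂'.map _).mul (hV.map (flatten M n properSubring))), ?_⟩
  have hconst : ∀ {k l : ℕ} (Z : Matrix (Fin k) (Fin l) ℂ),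
      (Z.map properConst).map properSubring.subtype = Z.map RatFunc.C := fun Z => rfl
  have hconst' : ∀ Z : Matrix (Fin (M + 1) × Fin n) (Fin (M + 1) × Fin n) ℂ,
      (properConst.mapMatrix Z).map properSubring.subtype = Z.map RatFunc.C := fun Z => rfl
  have hgmap : g.map properSubring.subtype = S.C.map RatFunc.C *
      ((RatFunc.X : RatFunc ℂ) • S.E.map RatFunc.C - S.A.map RatFunc.C)⁻¹ *
        S.B.map RatFunc.C := by
    rw [hg, Matrix.map_mul, Matrix.map_mul, hconst, hconst, inv_eq_right_inv hY]
  clear_value g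
  have h' := congrArg (fun Z => (flatten M n properSubring Z).map properSubring.subtype) h
  have hsum : (∑ j ∈ range (M + 1), properXInv ^ j • properConst.mapMatrix (S.coeff (M + 1 - j)) +
      properXInv ^ (M + 1) • (properConst.mapMatrix (S.coeff 0) + g)).map properSubring.subtype =
      ((RatFunc.X : RatFunc ℂ) ^ (M + 1))⁻¹ • S.transferFunction := by
    rw [Realization.transferFunction, ← hgmap, ← transferFunction_eq_sum S hdeg]
    ext a b
    simp only [map_apply, Matrix.add_apply, Matrix.sum_apply, Matrix.smul_apply, smul_eq_mul,
      map_add, map_sum, map_mul, map_pow]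
    rfl
  have hD : (properXInv • lastDiag (M + 1) (-(properConst.mapMatrix (S.coeff 0) + g))).map
      properSubring.subtype = (RatFunc.X : RatFunc ℂ)⁻¹ •
        lastDiag (M + 1) (-((S.coeff 0).map RatFunc.C + g.map properSubring.subtype)) := by
    have e : -((S.coeff 0).map RatFunc.C + g.map properSubring.subtype) =
        (-(properConst.mapMatrix (S.coeff 0) + g)).map properSubring.subtype := by
      ext a b
      simp only [map_apply, Matrix.neg_apply, Matrix.add_apply, map_neg, map_add]
      rfl
    rw [e, ← map_lastDiag]
    ext a b
    simp only [map_apply, Matrix.smul_apply, smul_eq_mul, map_mul]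
    rfl
  have hW : ((flatten M n properSubring)
      ((leadingBlock M S α β).map properConst.mapMatrix)).map properSubring.subtype =
        (flatten M n ℂ (leadingBlock M S α β)).map RatFunc.C := rfl
  simp only [← map_leadingBlock, map_mul, map_sub, flatten_smul, ← lastDiag_eq, Matrix.map_mul,
    Matrix.map_sub _ (map_sub properSubring.subtype), hW, hD, map_lastDiag, hsum] at h'
  have e1 : lastDiag (M + 1) (-(S.coeff 0).map RatFunc.C) =
      lastDiag (M + 1) (-((S.coeff 0).map RatFunc.C + g.map properSubring.subtype)) +
        lastCol (M + 1) (S.C.map RatFunc.C) *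
          ((RatFunc.X : RatFunc ℂ) • S.E.map RatFunc.C - S.A.map RatFunc.C)⁻¹ *
            lastRow (M + 1) (S.B.map RatFunc.C) := by
    rw [← lastDiag_add, ← hgmap, neg_add, neg_add_cancel_right]
  rw [← h', transferFunction_equivalentRealization, e1, ← sub_sub, sub_add_cancel, Matrix.map_mul,
    Matrix.map_mul, hconst', hconst']
  have hΨ₁c : Ψ₁.map RatFunc.C * Φ₁.map RatFunc.C = 1 := by
    rw [← Matrix.map_mul, hΨ₁]
    simp
  have hΨ₂c : Φ₂.map RatFunc.C * Ψ₂.map RatFunc.C = 1 := by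
    rw [← Matrix.map_mul, hΨ₂]
    simp
  generalize (flatten M n ℂ (leadingBlock M S α β)).map RatFunc.C = W
  generalize lastDiag (M + 1) (-((S.coeff 0).map RatFunc.C + g.map properSubring.subtype)) = D
  generalize (flatten M n properSubring U).map properSubring.subtype = u
  generalize (flatten M n properSubring V).map properSubring.subtype = v
  generalize Φ₁.map RatFunc.C = φ₁ at *
  generalize Φ₂.map RatFunc.C = φ₂ at *
  generalize Ψ₁.map RatFunc.C = ψ₁ at *
  generalize Ψ₂.map RatFunc.C = ψ₂ at *
  have e2 : (RatFunc.X : RatFunc ℂ)⁻¹ • (φ₁ * ((RatFunc.X : RatFunc ℂ) • W - D) * φ₂) =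
      φ₁ * (W - (RatFunc.X : RatFunc ℂ)⁻¹ • D) * φ₂ := by
    rw [← Matrix.smul_mul, ← Matrix.mul_smul, smul_sub, smul_smul,
      inv_mul_cancel₀ RatFunc.X_ne_zero, one_smul]
  calc u * ψ₁ * ((RatFunc.X : RatFunc ℂ)⁻¹ • (φ₁ * ((RatFunc.X : RatFunc ℂ) • W - D) * φ₂)) *
        (ψ₂ * v) = u * (ψ₁ * φ₁) * (W - (RatFunc.X : RatFunc ℂ)⁻¹ • D) * ((φ₂ * ψ₂) * v) := by
        rw [e2]
        simp only [Matrix.mul_assoc]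
    _ = u * (W - (RatFunc.X : RatFunc ℂ)⁻¹ • D) * v := by
        rw [hΨ₁c, hΨ₂c, Matrix.mul_one, Matrix.one_mul]

/-- Strict system equivalence of the pencil with `diag(I, 𝒮(λ))`, from the equivalence of the
polynomial part. -/
theorem fromBlocks_mul_systemMatrix_mul (S : Realization (Fin n) r)
    {W Φ₁ Φ₂ Ψ₁ Ψ₂ : Matrix (Fin (M + 1) × Fin n) (Fin (M + 1) × Fin n) ℂ}
    {R₁ R₂ : Matrix (Fin r) (Fin r) ℂ} (h₁ : IsUnit R₁) (h₂ : IsUnit R₂)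
    {U V : Matrix (Fin (M + 1) × Fin n) (Fin (M + 1) × Fin n) ℂ[X]}
    (hΨ₁ : Ψ₁ * Φ₁ = 1) (hΨ₂ : Φ₂ * Ψ₂ = 1)
    (hU : ∀ Z : Matrix (Fin n) (Fin r) ℂ[X], U * lastCol (M + 1) Z = lastCol (M + 1) Z)
    (hV : ∀ Z : Matrix (Fin r) (Fin n) ℂ[X], lastRow (M + 1) Z * V = lastRow (M + 1) Z)
    (h : U * ((X : ℂ[X]) • W.map Polynomial.C -
        (lastDiag (M + 1) (-S.coeff 0)).map Polynomial.C) * V = lastDiag (M + 1) S.P) :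
    fromBlocks (U * Ψ₁.map Polynomial.C) 0 0 (R₁⁻¹.map Polynomial.C) *
        (equivalentRealization S W Φ₁ Φ₂ R₁ R₂ h₁ h₂).systemMatrix *
        fromBlocks (Ψ₂.map Polynomial.C * V) 0 0 (R₂⁻¹.map Polynomial.C) =
      padIdentity (M + 1) S.systemMatrix := by
  have hΨ₁c : Ψ₁.map Polynomial.C * Φ₁.map Polynomial.C = 1 := by
    rw [← Matrix.map_mul, hΨ₁]
    simp
  have hΨ₂c : Φ₂.map Polynomial.C * Ψ₂.map Polynomial.C = 1 := by
    rw [← Matrix.map_mul, hΨ₂]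
    simp
  have hR₁ : R₁⁻¹.map Polynomial.C * R₁.map Polynomial.C = 1 := by
    rw [← Matrix.map_mul, nonsing_inv_mul _ ((isUnit_iff_isUnit_det _).1 h₁)]
    simp
  have hR₂ : R₂.map Polynomial.C * R₂⁻¹.map Polynomial.C = 1 := by
    rw [← Matrix.map_mul, mul_nonsing_inv _ ((isUnit_iff_isUnit_det _).1 h₂)]
    simp
  have assoc : ∀ x y z w v : Matrix ((Fin (M + 1) × Fin n) ⊕ Fin r)
      ((Fin (M + 1) × Fin n) ⊕ Fin r) ℂ[X], x * (y * z * w) * v = x * y * z * (w * v) := by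
    intro x y z w v
    simp only [Matrix.mul_assoc]
  rw [systemMatrix_equivalentRealization_eq, assoc, fromBlocks_diag_mul, fromBlocks_diag_mul, hR₁,
    hR₂, Matrix.mul_assoc U, hΨ₁c, Matrix.mul_one, ← Matrix.mul_assoc, hΨ₂c, Matrix.one_mul,
    fromBlocks_multiply, fromBlocks_multiply, padIdentity, Realization.systemMatrix]
  simp only [Matrix.zero_mul, Matrix.mul_zero, add_zero, zero_add, Matrix.one_mul, Matrix.mul_one,
    hU, hV, h, toBlocks_fromBlocks₁₁, toBlocks_fromBlocks₁₂, toBlocks_fromBlocks₂₁,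
    toBlocks_fromBlocks₂₂]

/-- The operations take the transfer function to diag(I, …, I, G), because they leave the coupling
term unchanged. Reading off the last block exhibits G as a polynomial multiple, on both sides, of
the transfer function of the pencil. -/
theorem isMinimal_equivalentRealization {S : Realization (Fin n) r} (hS : S.IsMinimal)
    {W Φ₁ Φ₂ Ψ₁ Ψ₂ : Matrix (Fin (M + 1) × Fin n) (Fin (M + 1) × Fin n) ℂ}
    {R₁ R₂ : Matrix (Fin r) (Fin r) ℂ} (h₁ : IsUnit R₁) (h₂ : IsUnit R₂)
    {U V : Matrix (Fin (M + 1) × Fin n) (Fin (M + 1) × Fin n) ℂ[X]}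
    (hΨ₁ : Ψ₁ * Φ₁ = 1) (hΨ₂ : Φ₂ * Ψ₂ = 1)
    (hU : ∀ Z : Matrix (Fin n) (Fin r) ℂ[X], U * lastCol (M + 1) Z = lastCol (M + 1) Z)
    (hV : ∀ Z : Matrix (Fin r) (Fin n) ℂ[X], lastRow (M + 1) Z * V = lastRow (M + 1) Z)
    (h : U * ((X : ℂ[X]) • W.map Polynomial.C -
        (lastDiag (M + 1) (-S.coeff 0)).map Polynomial.C) * V = lastDiag (M + 1) S.P) :
    (equivalentRealization S W Φ₁ Φ₂ R₁ R₂ h₁ h₂).IsMinimal := by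
  refine isMinimal_of_mul_mul hS
    (U := lastRow (M + 1) (1 : Matrix (Fin n) (Fin n) ℂ[X]) * (U * Ψ₁.map Polynomial.C))
    (V := Ψ₂.map Polynomial.C * V * lastCol (M + 1) (1 : Matrix (Fin n) (Fin n) ℂ[X])) ?_
  have hΨ₁c : Ψ₁.map RatFunc.C * Φ₁.map RatFunc.C = 1 := by
    rw [← Matrix.map_mul, hΨ₁]
    simp
  have hΨ₂c : Φ₂.map RatFunc.C * Ψ₂.map RatFunc.C = 1 := by
    rw [← Matrix.map_mul, hΨ₂]
    simp
  have hU' := congrArg (fun Y => Y.map (algebraMap ℂ[X] (RatFunc ℂ))) (hU (S.C.map Polynomial.C))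
  have hV' := congrArg (fun Y => Y.map (algebraMap ℂ[X] (RatFunc ℂ))) (hV (S.B.map Polynomial.C))
  have h' := congrArg (fun Y => Y.map (algebraMap ℂ[X] (RatFunc ℂ))) h
  have hK : (((X : ℂ[X]) • W.map Polynomial.C -
      (lastDiag (M + 1) (-S.coeff 0)).map Polynomial.C).map (algebraMap ℂ[X] (RatFunc ℂ))) =
      (RatFunc.X : RatFunc ℂ) • W.map RatFunc.C -
        lastDiag (M + 1) (-(S.coeff 0).map RatFunc.C) := map_pencil_lastDiag S W
  have hone : (1 : Matrix (Fin n) (Fin n) ℂ[X]).map (algebraMap ℂ[X] (RatFunc ℂ)) = 1 := by simp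
  simp only [Matrix.map_mul, map_lastCol, map_lastRow, map_map_C, hK, hone] at hU' hV' h' ⊢
  rw [map_lastDiag] at h'
  rw [transferFunction_equivalentRealization]
  set u := U.map (algebraMap ℂ[X] (RatFunc ℂ))
  set v := V.map (algebraMap ℂ[X] (RatFunc ℂ))
  set c := lastCol (M + 1) (S.C.map RatFunc.C)
  set b := lastRow (M + 1) (S.B.map RatFunc.C)
  set Y := ((RatFunc.X : RatFunc ℂ) • S.E.map RatFunc.C - S.A.map RatFunc.C)⁻¹
  set K := (RatFunc.X : RatFunc ℂ) • W.map RatFunc.C -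
    lastDiag (M + 1) (-(S.coeff 0).map RatFunc.C)
  have e : u * (K + c * Y * b) * v =
      lastDiag (M + 1) (S.P.map (algebraMap ℂ[X] (RatFunc ℂ))) + c * Y * b := by
    rw [Matrix.mul_add, Matrix.add_mul, h', ← Matrix.mul_assoc u, ← Matrix.mul_assoc u, hU',
      Matrix.mul_assoc _ b, hV']
  have e' : Ψ₁.map RatFunc.C * (Φ₁.map RatFunc.C * (K + c * Y * b) * Φ₂.map RatFunc.C) *
      Ψ₂.map RatFunc.C = K + c * Y * b := by
    simp only [Matrix.mul_assoc _ (Φ₂.map _), Matrix.mul_assoc _ _ (Ψ₂.map _), hΨ₂c,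
      Matrix.mul_one]
    rw [← Matrix.mul_assoc, hΨ₁c, Matrix.one_mul]
  calc _ = lastRow (M + 1) (1 : Matrix (Fin n) (Fin n) (RatFunc ℂ)) *
        (u * (Ψ₁.map RatFunc.C * (Φ₁.map RatFunc.C * (K + c * Y * b) * Φ₂.map RatFunc.C) *
          Ψ₂.map RatFunc.C) * v) * lastCol (M + 1) (1 : Matrix (Fin n) (Fin n) (RatFunc ℂ)) := by
        simp only [Matrix.mul_assoc]
    _ = S.transferFunction := by
        rw [e', e, ← lastDiag_add, lastRow_mul_lastDiag_mul_lastCol, Realization.transferFunction]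

end Linearization

end RatMat

theorem theorem3p12 {n m r : ℕ} (hm : 1 ≤ m)
    (G : Matrix (Fin n) (Fin n) (RatFunc ℂ))
    (S : RatMat.Realization (Fin n) r)
    -- `P(λ) = A_0 + λ A_1 + ⋯ + λ ^ m A_m` with `A_m ≠ 0`
    (hdeg : ∀ a b, (S.P a b).natDegree ≤ m) (hlead : S.coeff m ≠ 0)
    -- `G(λ) = P(λ) + C (λ E - A)⁻¹ B`, a minimal realization
    (hG : G = S.transferFunction) (hmin : S.IsMinimal)
    -- `(ω₀, ω₁)` is a permutation of `{0, …, m}` with `0 ∈ ω₀`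
    (ω₀ ω₁ : List ℕ) (hω : (ω₀ ++ ω₁).Perm (List.range (m + 1))) (h0 : 0 ∈ ω₀)
    -- if the index `m` is used in `ω₀`, the inverse of the Fiedler matrix `-m` has to exist
    (hinv : m ∈ ω₀ → IsUnit (S.coeff m).det) :
    RatMat.IsRosenbrockStrongLinearization m G S (RatMat.gfp m S ω₀ ω₁) := by
  obtain ⟨M, rfl⟩ : ∃ M, m = M + 1 := ⟨m - 1, by omega⟩
  obtain ⟨Φ₁, Φ₂, R₁, R₂, α, β, hΦ₁, hΦ₂, h₁, h₂, hαβ, e₀, e₁⟩ :=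
    RatMat.exists_fiedlerProd_eq S ω₀ ω₁ hω h0 hinv
  obtain ⟨U, V, hU, hV, hU', hV', h⟩ :=
    RatMat.exists_isUnit_mul_pencil_eq_lastDiag S hdeg α β hαβ
  obtain ⟨Ψ₁, hΨ₁⟩ := hΦ₁.exists_left_inv
  obtain ⟨Ψ₂, hΨ₂⟩ := hΦ₂.exists_right_inv
  have hΨ₁' : IsUnit Ψ₁ := RatMat.isUnit_of_mul_eq_one_and hΨ₁ (mul_eq_one_comm.1 hΨ₁)
  have hΨ₂' : IsUnit Ψ₂ := RatMat.isUnit_of_mul_eq_one_and (mul_eq_one_comm.1 hΨ₂) hΨ₂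
  have hL : RatMat.gfp (M + 1) S ω₀ ω₁ = (RatMat.equivalentRealization S
      (RatMat.flatten M n ℂ (RatMat.leadingBlock M S α β)) Φ₁ Φ₂ R₁ R₂ h₁ h₂).systemMatrix := by
    rw [RatMat.gfp_eq, e₀, e₁, RatMat.systemMatrix_equivalentRealization]
  refine ⟨RatMat.equivalentRealization S (RatMat.flatten M n ℂ (RatMat.leadingBlock M S α β))
    Φ₁ Φ₂ R₁ R₂ h₁ h₂,
    -- The signs convert λΦ₁WΦ₂ - Φ₁M_0Φ₂ to the required form 𝒳 - λ𝒴.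
    ⟨-(Φ₁ * RatMat.lastDiag (M + 1) (-S.coeff 0) * Φ₂),
      -(Φ₁ * RatMat.flatten M n ℂ (RatMat.leadingBlock M S α β) * Φ₂), ?_⟩, hL,
    RatMat.isMinimal_equivalentRealization hmin h₁ h₂ hΨ₁ hΨ₂ hU' hV' h,
    ⟨U * Ψ₁.map Polynomial.C, Ψ₂.map Polynomial.C * V, R₁⁻¹, R₂⁻¹,
      RatMat.isUnimodular_of_isUnit (hU.mul (hΨ₁'.map (Polynomial.C (R := ℂ)).mapMatrix)),
      RatMat.isUnimodular_of_isUnit ((hΨ₂'.map (Polynomial.C (R := ℂ)).mapMatrix).mul hV),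
      ?_, ?_, ?_⟩, ?_⟩
  · rw [RatMat.map_neg_C, RatMat.map_neg_C, smul_neg, sub_neg_eq_add, neg_add_eq_sub]
    simp only [RatMat.equivalentRealization, Matrix.map_mul, Matrix.mul_sub, Matrix.sub_mul,
      Matrix.mul_smul, Matrix.smul_mul]
  · exact Matrix.isUnit_nonsing_inv_det _ ((Matrix.isUnit_iff_isUnit_det _).1 h₁)
  · exact Matrix.isUnit_nonsing_inv_det _ ((Matrix.isUnit_iff_isUnit_det _).1 h₂)
  · rw [hL, RatMat.fromBlocks_mul_systemMatrix_mul S h₁ h₂ hΨ₁ hΨ₂ hU' hV' h]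
  · rw [hG]
    exact RatMat.exists_isBiproper_mul_mul S hdeg α β hαβ hΦ₁ hΦ₂ h₁ h₂
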